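/- There is an absolute constant $C>0$ such that the following holds. Let $n\ge 1$, and let $A=(A_{ij})$ be the adjacency matrix of an inhomogeneous Erdős–Rényi random graph $G(n,(p_{ij}))$, that is, a random symmetric $n\times n$ matrix with entries in $\{0,1\}$ whose entries $A_{ij}$, $i\le j$, are independent with $\mathbb P(A_{ij}=1)=p_{ij}$ (a graph without self-loops corresponds to $p_{ii}=0$ for all $i$). Let $d=\max_{i,j} n p_{ij}$. Given a realization of $A$ and a set $S$ of at most $10n/d$ vertices (any set of vertices if $d=0$), call a real symmetric $n\times n$ matrix $A'$ an admissible regularization of $A$ if it is obtained by reducing the weights of the edges incident to $S$ in an arbitrary way, so that all degrees become at most $2d$; that is, $0\le A'_{ij}\le A_{ij}$ for all $i,j$, $A'_{ij}=A_{ij}$ whenever $i,j\notin S$, and $\sum_{j} A'_{ij}\le 2d$ for all $i$. Then for every real $r\ge 1$, with probability at least $1-n^{-r}$, simultaneously for all sets $S$ of at most $10n/d$ vertices and all corresponding admissible regularizations $A'$, $$ \|A'-\mathbb E A\|\le C\,r^{3/2}\sqrt d , $$ where $\|\cdot\|$ is the spectral norm (the operator norm on Euclidean $\mathbb R^n$).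 -/

import Mathlib

open MeasureTheory ProbabilityTheory

/-- `A` is the (random) adjacency matrix of an inhomogeneous Erdős–Rényi graph `G(n, (p i j))`
on the vertex set `Fin n`: a random symmetric 0/1 matrix whose entries on and above the diagonal
are independent, with `ℙ (A i j = 1) = p i j`. Loops are allowed; the graph without loops is the
case `p i i = 0` for all `i`. -/
structure IsInhomogeneousER {n : ℕ} {Ω : Type*} [MeasurableSpace Ω] (μ : Measure Ω)
    (p : Matrix (Fin n) (Fin n) ℝ) (A : Ω → Matrix (Fin n) (Fin n) ℝ) : Prop where
  measurable_entry : ∀ i j, Measurable fun ω => A ω i j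
  zero_or_one : ∀ ω i j, A ω i j = 0 ∨ A ω i j = 1
  symm : ∀ ω, (A ω).IsSymm
  prob_edge : ∀ i j, μ.real {ω | A ω i j = 1} = p i j
  indep : iIndepFun
    (fun (e : {e : Fin n × Fin n // e.1 ≤ e.2}) (ω : Ω) => A ω e.1.1 e.1.2) μ

/-- The entrywise expectation `𝔼 A` of a random matrix. -/
noncomputable def expectedMatrix {n : ℕ} {Ω : Type*} [MeasurableSpace Ω] (μ : Measure Ω)
    (A : Ω → Matrix (Fin n) (Fin n) ℝ) : Matrix (Fin n) (Fin n) ℝ :=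
  Matrix.of fun i j => ∫ ω, A ω i j ∂μ

/-- The weighted degree of the vertex `i` in the network with weighted adjacency matrix `M`. -/
def weightedDegree {n : ℕ} (M : Matrix (Fin n) (Fin n) ℝ) (i : Fin n) : ℝ :=
  ∑ j, M i j

/-- `A'` is the adjacency matrix of a weighted undirected network obtained from the one with
adjacency matrix `A` by reducing (to arbitrary smaller nonnegative values) the weights of edges
incident to the vertices in `S`; all other edges keep their weight. -/
structure IsWeightReduction {n : ℕ} (A : Matrix (Fin n) (Fin n) ℝ) (S : Finset (Fin n))
    (A' : Matrix (Fin n) (Fin n) ℝ) : Prop where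
  symm : A'.IsSymm
  nonneg : ∀ i j, 0 ≤ A' i j
  le : ∀ i j, A' i j ≤ A i j
  eq_of_notMem : ∀ i j, i ∉ S → j ∉ S → A' i j = A i j

/-- The spectral norm of a square real matrix: the operator norm on Euclidean space. -/
noncomputable def matrixSpectralNorm {n : ℕ} (M : Matrix (Fin n) (Fin n) ℝ) : ℝ :=
  ‖Matrix.toEuclideanCLM (n := Fin n) (𝕜 := ℝ) M‖

/-! A `1/2`-net reduces the norm to at most `25 ^ n` bilinear forms, and each form is split at `|x i
* y j| = √d / n` into light and heavy pairs (the Kahn–Szemerédi method).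

On light pairs the matrix `A'` may depend on `A` adversarially, but only on edges meeting `S`.
Bounding that change by absolute weights (`bilinear_weightReduction_le`) leaves linear statistics of
`A` with deterministic weights. Bernstein's inequality (`prob_light_ge_le`) then survives a union
over the net and over all `2 ^ n` sets `S`, and the mean of the extra term is `O(√d)` because `S`
has at most `10 n / d` vertices.

On heavy pairs the mean is small deterministically. For `A'` one needs only bounded degrees and the
discrepancy property, which holds for `A` with high probability (`prob_not_hasDiscrepancy_le`) and
passes to entrywise smaller matrices. Grouping the vectors into dyadic level sets, `dyadic_block_le`
bounds each block by terms whose sums are geometric. The discrepancy constant is linear in `r`, so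
the proof yields `r` in place of `r ^ (3/2)`. -/

/-- A double sum folded onto the pairs on and above the diagonal. -/
theorem sum_sum_eq_sum_le_pairs {n : ℕ} (f : Fin n → Fin n → ℝ) :
    ∑ i, ∑ j, f i j = ∑ e : {e : Fin n × Fin n // e.1 ≤ e.2},
      (f e.1.1 e.1.2 + if e.1.1 = e.1.2 then 0 else f e.1.2 e.1.1) := by
  have h1 : ∀ g : Fin n → Fin n → ℝ,
      ∑ e : {e : Fin n × Fin n // e.1 ≤ e.2}, g e.1.1 e.1.2
        = ∑ i, ∑ j, if i ≤ j then g i j else 0 := by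
    intro g
    rw [← Finset.sum_product', Finset.univ_product_univ, ← Finset.sum_filter]
    exact (Finset.sum_subtype _ (by simp) (fun e : Fin n × Fin n => g e.1 e.2)).symm
  rw [h1 (fun i j => f i j + if i = j then 0 else f j i)]
  have h2 : ∀ i j, f i j = (if i ≤ j then f i j else 0) + if j < i then f i j else 0 := by
    intro i j
    by_cases h : i ≤ j
    · simp [h, not_lt.2 h]
    · simp [h, not_le.1 h]
  calc ∑ i, ∑ j, f i j
      = ∑ i, ∑ j, ((if i ≤ j then f i j else 0) + if j < i then f i j else 0) := by
        refine Finset.sum_congr rfl fun i _ => Finset.sum_congr rfl fun j _ => h2 i j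
    _ = ∑ i, ∑ j, (if i ≤ j then f i j else 0) + ∑ i, ∑ j, (if i < j then f j i else 0) := by
        simp only [Finset.sum_add_distrib]
        congr 1
        exact Finset.sum_comm
    _ = _ := by
        simp only [← Finset.sum_add_distrib]
        refine Finset.sum_congr rfl fun i _ => Finset.sum_congr rfl fun j _ => ?_
        rcases lt_trichotomy i j with h | h | h
        · simp [h, h.le, h.ne]
        · simp [h]
        · simp [not_lt.2 h.le, not_le.2 h]

/-! ### Exponential moments and Bernstein's inequality. -/

namespace IsInhomogeneousER

variable {n : ℕ} {Ω : Type*} [MeasurableSpace Ω] {μ : Measure Ω}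
  {p : Matrix (Fin n) (Fin n) ℝ} {A : Ω → Matrix (Fin n) (Fin n) ℝ}

theorem entry_comm (h : IsInhomogeneousER μ p A) (ω : Ω) (i j : Fin n) : A ω i j = A ω j i :=
  ((h.symm ω).apply i j).symm

theorem prob_nonneg (h : IsInhomogeneousER μ p A) (i j : Fin n) : 0 ≤ p i j := by
  rw [← h.prob_edge]; exact measureReal_nonneg

theorem prob_comm (h : IsInhomogeneousER μ p A) (i j : Fin n) : p i j = p j i := by
  rw [← h.prob_edge, ← h.prob_edge]
  congr 1
  ext ω
  simp [h.entry_comm ω i j]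

variable [IsProbabilityMeasure μ]

theorem integral_comp_entry (h : IsInhomogeneousER μ p A) (φ : ℝ → ℝ) (i j : Fin n) :
    ∫ ω, φ (A ω i j) ∂μ = φ 0 + p i j * (φ 1 - φ 0) := by
  have hm : MeasurableSet {ω | A ω i j = 1} :=
    h.measurable_entry i j (measurableSet_singleton 1)
  have e : (fun ω => φ (A ω i j)) =
      fun ω => φ 0 + Set.indicator {ω | A ω i j = 1} (fun _ => φ 1 - φ 0) ω := by
    ext ω
    rcases h.zero_or_one ω i j with h | h <;> simp [Set.indicator, h]
  rw [e, integral_add (integrable_const _) ((integrable_const _).indicator hm),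
    integral_indicator_const _ hm, h.prob_edge]
  simp

theorem expectedMatrix_eq (h : IsInhomogeneousER μ p A) : expectedMatrix μ A = p := by
  ext i j
  simpa [expectedMatrix] using h.integral_comp_entry id i j

theorem integrable_exp_sum (h : IsInhomogeneousER μ p A) (w : Fin n → Fin n → ℝ) :
    Integrable (fun ω => Real.exp (∑ i, ∑ j, w i j * A ω i j)) μ := by
  have hm : Measurable fun ω => ∑ i, ∑ j, w i j * A ω i j :=
    Finset.measurable_sum _ fun i _ => Finset.measurable_sum _ fun j _ =>
      (h.measurable_entry i j).const_mul _
  refine Integrable.of_bound (Real.measurable_exp.comp hm).aestronglyMeasurable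
    (Real.exp (∑ i, ∑ j, |w i j|)) (Filter.Eventually.of_forall fun ω => ?_)
  rw [Real.norm_eq_abs, Real.abs_exp, Real.exp_le_exp]
  refine Finset.sum_le_sum fun i _ => Finset.sum_le_sum fun j _ => ?_
  rcases h.zero_or_one ω i j with h | h <;> simp [h, le_abs_self]

/-- Exponential moments of linear statistics of the adjacency matrix. -/
theorem integral_exp_sum_le (h : IsInhomogeneousER μ p A) (w : Fin n → Fin n → ℝ) :
    ∫ ω, Real.exp (∑ i, ∑ j, w i j * A ω i j) ∂μ ≤
      Real.exp ((∑ i, ∑ j, p i j * (Real.exp (2 * w i j) - 1)) / 2) := by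
  set c : {e : Fin n × Fin n // e.1 ≤ e.2} → ℝ := fun e =>
    w e.1.1 e.1.2 + if e.1.1 = e.1.2 then 0 else w e.1.2 e.1.1 with hc
  have h1 : ∀ ω, Real.exp (∑ i, ∑ j, w i j * A ω i j)
      = ∏ e, Real.exp (c e * A ω e.1.1 e.1.2) := by
    intro ω
    rw [sum_sum_eq_sum_le_pairs, ← Real.exp_sum]
    congr 1
    refine Finset.sum_congr rfl fun e _ => ?_
    simp only [hc]
    split_ifs
    · ring
    · rw [h.entry_comm ω e.1.2 e.1.1]; ring
  simp_rw [h1]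
  rw [h.indep.integral_fun_prod_comp (f := fun e x => Real.exp (c e * x))
    (fun e => (h.measurable_entry _ _).aemeasurable)
    (fun e => (by fun_prop : Measurable fun x : ℝ => Real.exp (c e * x)).aestronglyMeasurable),
    sum_sum_eq_sum_le_pairs, Finset.sum_div, Real.exp_sum]
  refine Finset.prod_le_prod (fun e _ => integral_nonneg fun ω => (Real.exp_pos _).le)
    fun e _ => ?_
  rw [h.integral_comp_entry (fun x => Real.exp (c e * x))]
  simp only [mul_zero, Real.exp_zero, mul_one]
  refine (add_comm _ _).trans_le ((Real.add_one_le_exp _).trans (Real.exp_le_exp.2 ?_))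
  rw [h.prob_comm e.1.2 e.1.1]
  have hp := h.prob_nonneg e.1.1 e.1.2
  have hsq : ∀ x : ℝ, Real.exp (2 * x) = Real.exp x ^ 2 := fun x => by
    rw [← Real.exp_nat_mul]; norm_num
  simp only [hc, hsq]
  -- Both cases are AM-GM. Off the diagonal, `e^(a+b)` is at most the mean of `e^(2a)` and `e^(2b)`:
  -- this is the source of the doubled weights and the halved sum, which then runs over all ordered
  -- pairs.
  split_ifs
  · rw [add_zero, add_zero, mul_div_assoc]
    refine mul_le_mul_of_nonneg_left ?_ hp
    nlinarith [sq_nonneg (Real.exp (w e.1.1 e.1.2) - 1)]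
  · rw [← mul_add, mul_div_assoc, Real.exp_add]
    refine mul_le_mul_of_nonneg_left ?_ hp
    nlinarith [sq_nonneg (Real.exp (w e.1.1 e.1.2) - Real.exp (w e.1.2 e.1.1))]

/-- The Chernoff bound for linear statistics of the adjacency matrix. -/
theorem prob_sum_ge_le (h : IsInhomogeneousER μ p A) (w : Fin n → Fin n → ℝ) (t : ℝ) :
    μ.real {ω | t ≤ ∑ i, ∑ j, w i j * A ω i j} ≤
      Real.exp ((∑ i, ∑ j, p i j * (Real.exp (2 * w i j) - 1)) / 2 - t) := by
  have h1 := measure_ge_le_exp_mul_mgf (μ := μ) (X := fun ω => ∑ i, ∑ j, w i j * A ω i j) t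
    (zero_le_one) (by simpa using h.integrable_exp_sum w)
  refine h1.trans ?_
  rw [sub_eq_add_neg, add_comm, Real.exp_add]
  simp only [mgf, one_mul, neg_mul]
  exact mul_le_mul_of_nonneg_left (h.integral_exp_sum_le w) (Real.exp_pos _).le

/-- Bernstein's inequality for weights of size at most `√d / n`. -/
theorem prob_light_ge_le (h : IsInhomogeneousER μ p A) {d : ℝ} (hd : 0 < d) (hn : 0 < n)
    (hp : ∀ i j, n * p i j ≤ d) (a : Fin n → Fin n → ℝ)
    (ha : ∀ i j, |a i j| ≤ √d / n) (ha2 : ∑ i, ∑ j, a i j ^ 2 ≤ 1) (t : ℝ) :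
    μ.real {ω | t * √d ≤ ∑ i, ∑ j, a i j * (A ω i j - p i j)} ≤
      Real.exp (-(n / 2 * (t - 1))) := by
  have hn' : (0 : ℝ) < n := by exact_mod_cast hn
  have hs : 0 < √d := Real.sqrt_pos.2 hd
  -- The largest tilt keeping `|2 l a i j| ≤ 1`, so that `e^x ≤ 1 + x + x²` applies; it also makes
  -- the variance factor `(d / n) (2 l)²` equal to `n`.
  set l : ℝ := n / (2 * √d) with hl
  have hl0 : 0 < l := by positivity
  have h1 := h.prob_sum_ge_le (fun i j => l * a i j) (l * (t * √d) + l * ∑ i, ∑ j, a i j * p i j)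
  have e1 : {ω | l * (t * √d) + l * ∑ i, ∑ j, a i j * p i j ≤ ∑ i, ∑ j, l * a i j * A ω i j}
      = {ω | t * √d ≤ ∑ i, ∑ j, a i j * (A ω i j - p i j)} := by
    ext ω
    simp only [Set.mem_ofPred_eq, mul_assoc, ← Finset.mul_sum, mul_sub, Finset.sum_sub_distrib]
    rw [← mul_add, mul_le_mul_iff_right₀ hl0, le_sub_iff_add_le]
  rw [e1] at h1
  refine h1.trans (Real.exp_le_exp.2 ?_)
  have h2 : ∀ i j, p i j * (Real.exp (2 * (l * a i j)) - 1) ≤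
      2 * l * (a i j * p i j) + d / n * (2 * l) ^ 2 * a i j ^ 2 := by
    intro i j
    have hx : |2 * (l * a i j)| ≤ 1 := by
      rw [← mul_assoc, abs_mul, abs_of_pos (by positivity)]
      calc 2 * l * |a i j| ≤ 2 * l * (√d / n) := by gcongr; exact ha i j
        _ = 1 := by rw [hl]; field_simp
    have := (abs_le.1 (Real.abs_exp_sub_one_sub_id_le hx)).2
    have hp1 : p i j ≤ d / n := by rw [le_div_iff₀ hn', mul_comm]; exact hp i j
    have hp0 := h.prob_nonneg i j
    calc p i j * (Real.exp (2 * (l * a i j)) - 1)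
        ≤ p i j * (2 * (l * a i j) + (2 * (l * a i j)) ^ 2) := by gcongr; linarith
      _ = 2 * l * (a i j * p i j) + p i j * (2 * (l * a i j)) ^ 2 := by ring
      _ ≤ 2 * l * (a i j * p i j) + d / n * (2 * (l * a i j)) ^ 2 := by gcongr
      _ = _ := by ring
  have h3 := Finset.sum_le_sum fun i (_ : i ∈ Finset.univ) =>
    Finset.sum_le_sum fun j (_ : j ∈ Finset.univ) => h2 i j
  simp only [Finset.sum_add_distrib, ← Finset.mul_sum] at h3
  have h4 : d / n * (2 * l) ^ 2 = n := by
    rw [hl]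
    field_simp
    rw [Real.sq_sqrt hd.le]
  have h5 : l * (t * √d) = n / 2 * t := by rw [hl]; field_simp
  rw [h4] at h3
  rw [h5]
  nlinarith

end IsInhomogeneousER

/-! ### The discrepancy property. -/

/-- The entropy weight `m log (e n / m)` of a set of `m` vertices among `n`. -/
noncomputable def entropyWeight (n m : ℕ) : ℝ := m * (1 + Real.log (n / m))

/-- The total weight `e(I, J)` of the entries of `M` in the block `I × J`. -/
def blockSum {n : ℕ} (M : Matrix (Fin n) (Fin n) ℝ) (I J : Finset (Fin n)) : ℝ :=
  ∑ i ∈ I, ∑ j ∈ J, M i j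

/-- The discrepancy property: every block `I × J` with `0 < |I| ≤ |J|` either has total weight at
most `e² d |I| |J| / n`, or exceeds this by a controlled factor. -/
def HasDiscrepancy {n : ℕ} (d c : ℝ) (M : Matrix (Fin n) (Fin n) ℝ) : Prop :=
  ∀ I J : Finset (Fin n), 0 < I.card → I.card ≤ J.card →
    blockSum M I J ≤ Real.exp 2 * (d * I.card * J.card / n) ∨
    blockSum M I J * Real.log (blockSum M I J / (d * I.card * J.card / n)) ≤
      c * entropyWeight n J.card

/-- The weight is smallest at `m = 1`. This turns entropy bounds into powers of `n`, uniformly in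
the block size. -/
theorem one_add_log_le_entropyWeight {n m : ℕ} (hm : 0 < m) (hmn : m ≤ n) :
    1 + Real.log n ≤ entropyWeight n m := by
  have hm' : (0 : ℝ) < m := by exact_mod_cast hm
  have h1 : (1 : ℝ) ≤ m := by exact_mod_cast hm
  have hn' : (0 : ℝ) < n := by exact_mod_cast hm.trans_le hmn
  rw [entropyWeight, Real.log_div hn'.ne' hm'.ne']
  have h2 : Real.log m ≤ Real.log n := Real.log_le_log hm' (by exact_mod_cast hmn)
  have h3 := Real.log_le_sub_one_of_pos hm'
  nlinarith

/-- With `q = m / n ≤ 1`, each counted set contributes at least `q ^ m` to `∑ q ^ |I| = (1 + q) ^ n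
≤ e ^ m`. -/
theorem card_filter_card_le_exp_entropyWeight {n m : ℕ} (hm : 0 < m) (hmn : m ≤ n) :
    ((Finset.univ.filter fun I : Finset (Fin n) => I.card ≤ m).card : ℝ) ≤
      Real.exp (entropyWeight n m) := by
  have hm' : (0 : ℝ) < m := by exact_mod_cast hm
  have hn' : (0 : ℝ) < n := by exact_mod_cast hm.trans_le hmn
  have hq0 : (0 : ℝ) < m / n := by positivity
  have hq1 : (m / n : ℝ) ≤ 1 := by
    rw [div_le_one hn']; exact_mod_cast hmn
  have h1 : ((Finset.univ.filter fun I : Finset (Fin n) => I.card ≤ m).card : ℝ) * (m / n : ℝ) ^ m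
      ≤ (m / n + 1 : ℝ) ^ n := by
    have := Fintype.sum_pow_mul_eq_add_pow (Fin n) (m / n : ℝ) 1
    simp only [one_pow, mul_one, Fintype.card_fin] at this
    rw [← this, ← nsmul_eq_mul, ← Finset.sum_const]
    refine (Finset.sum_le_sum fun I hI => ?_).trans
      (Finset.sum_le_univ_sum_of_nonneg fun I => by positivity)
    exact pow_le_pow_of_le_one hq0.le hq1 (Finset.mem_filter.1 hI).2
  have h2 : (m / n + 1 : ℝ) ^ n ≤ Real.exp m := by
    calc (m / n + 1 : ℝ) ^ n ≤ Real.exp (m / n) ^ n := by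
          gcongr; exact Real.add_one_le_exp _
      _ = Real.exp m := by rw [← Real.exp_nat_mul]; congr 1; field_simp
  have h3 : Real.exp (entropyWeight n m) * (m / n : ℝ) ^ m = Real.exp m := by
    rw [← Real.exp_log (pow_pos hq0 m), ← Real.exp_add, entropyWeight, Real.log_pow,
      Real.log_div hn'.ne' hm'.ne', Real.log_div hm'.ne' hn'.ne']
    congr 1; ring
  have h4 := h1.trans h2
  rw [← h3] at h4
  exact le_of_mul_le_mul_right h4 (pow_pos hq0 m)

namespace IsInhomogeneousER

variable {n : ℕ} {Ω : Type*} [MeasurableSpace Ω] {μ : Measure Ω}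
  {p : Matrix (Fin n) (Fin n) ℝ} {A : Ω → Matrix (Fin n) (Fin n) ℝ}

theorem exists_nat_blockSum_eq (h : IsInhomogeneousER μ p A) (ω : Ω) (I J : Finset (Fin n)) :
    ∃ k ∈ Finset.range (n ^ 2 + 1), blockSum (A ω) I J = k := by
  have h1 : ∀ i j, A ω i j = ((if A ω i j = 1 then 1 else 0 : ℕ) : ℝ) := by
    intro i j
    rcases h.zero_or_one ω i j with h | h <;> simp [h]
  refine ⟨∑ i ∈ I, ∑ j ∈ J, if A ω i j = 1 then 1 else 0, ?_, ?_⟩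
  · rw [Finset.mem_range, Nat.lt_succ_iff]
    calc ∑ i ∈ I, ∑ j ∈ J, (if A ω i j = 1 then 1 else 0)
        ≤ ∑ i ∈ I, ∑ j ∈ J, 1 := by
          refine Finset.sum_le_sum fun i _ => Finset.sum_le_sum fun j _ => ?_
          split_ifs <;> simp
      _ = I.card * J.card := by simp
      _ ≤ n * n := by
          gcongr
          · simpa using I.card_le_univ
          · simpa using J.card_le_univ
      _ = n ^ 2 := (sq n).symm
  · rw [blockSum]
    push_cast
    refine Finset.sum_congr rfl fun i _ => Finset.sum_congr rfl fun j _ => ?_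
    simpa using h1 i j

variable [IsProbabilityMeasure μ]

/-- Chernoff with the tilt `L = log (k / ν)`, which balances `ν e^L = k`. The exponent is at most `k
/ 2 - k L / 2`, and `k ≥ e² ν` means `L ≥ 2`, so half of the gain absorbs the loss. -/
theorem prob_blockSum_ge_le (h : IsInhomogeneousER μ p A) {d : ℝ} (hd : 0 < d)
    (hp : ∀ i j, n * p i j ≤ d) {I J : Finset (Fin n)} (hI : 0 < I.card) (hJ : 0 < J.card)
    {k : ℝ} (hk : Real.exp 2 * (d * I.card * J.card / n) ≤ k) :
    μ.real {ω | k ≤ blockSum (A ω) I J} ≤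
      Real.exp (-(k * Real.log (k / (d * I.card * J.card / n)) / 4)) := by
  have hn : 0 < n := by
    obtain ⟨i, -⟩ := Finset.card_pos.1 hI
    exact i.pos
  have hn' : (0 : ℝ) < n := by exact_mod_cast hn
  have hI' : (0 : ℝ) < I.card := by exact_mod_cast hI
  have hJ' : (0 : ℝ) < J.card := by exact_mod_cast hJ
  set ν : ℝ := d * I.card * J.card / n with hν
  have hν0 : 0 < ν := by positivity
  have hk0 : 0 < k := (by positivity : 0 < Real.exp 2 * ν).trans_le hk
  set L := Real.log (k / ν) with hL
  have hL2 : 2 ≤ L := by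
    rw [hL, Real.le_log_iff_exp_le (by positivity), le_div_iff₀ hν0]
    exact hk
  have hexp : Real.exp L = k / ν := Real.exp_log (by positivity)
  have h1 := h.prob_sum_ge_le (fun i j => if i ∈ I ∧ j ∈ J then L / 2 else 0) (L / 2 * k)
  have e0 : ∀ f : Fin n → Fin n → ℝ, ∑ i, ∑ j, (if i ∈ I ∧ j ∈ J then f i j else 0)
      = ∑ i ∈ I, ∑ j ∈ J, f i j := by
    intro f
    simp [ite_and, Finset.sum_ite_mem, Finset.sum_ite_irrel]
  have e1 : {ω | L / 2 * k ≤ ∑ i, ∑ j, (if i ∈ I ∧ j ∈ J then L / 2 else 0) * A ω i j}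
      = {ω | k ≤ blockSum (A ω) I J} := by
    ext ω
    simp only [Set.mem_ofPred_eq, ite_mul, zero_mul, e0, ← Finset.mul_sum, blockSum]
    rw [mul_le_mul_iff_right₀ (by linarith)]
  rw [e1] at h1
  refine h1.trans (Real.exp_le_exp.2 ?_)
  have e2 : ∑ i, ∑ j, p i j * (Real.exp (2 * if i ∈ I ∧ j ∈ J then L / 2 else 0) - 1)
      = ∑ i ∈ I, ∑ j ∈ J, p i j * (Real.exp L - 1) := by
    rw [← e0]
    refine Finset.sum_congr rfl fun i _ => Finset.sum_congr rfl fun j _ => ?_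
    split_ifs
    · rw [mul_div_cancel₀ _ two_ne_zero]
    · simp
  have h2 : ∑ i ∈ I, ∑ j ∈ J, p i j * (Real.exp L - 1) ≤ k := by
    calc ∑ i ∈ I, ∑ j ∈ J, p i j * (Real.exp L - 1)
        ≤ ∑ i ∈ I, ∑ j ∈ J, d / n * Real.exp L := by
          refine Finset.sum_le_sum fun i _ => Finset.sum_le_sum fun j _ => ?_
          have hp1 : p i j ≤ d / n := by rw [le_div_iff₀ hn', mul_comm]; exact hp i j
          have hp0 := h.prob_nonneg i j
          exact mul_le_mul hp1 (by linarith) (by linarith [Real.add_one_le_exp L]) (by positivity)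
      _ = ν * Real.exp L := by
          simp only [Finset.sum_const, nsmul_eq_mul, hν]; ring
      _ = k := by rw [hexp]; field_simp
  rw [e2]
  nlinarith

/-- A block sum takes at most `n² + 1` integer values, so a union bound over the bad values
suffices. -/
theorem prob_not_discrepancy_block_le (h : IsInhomogeneousER μ p A) {d : ℝ} (hd : 0 < d)
    (hp : ∀ i j, n * p i j ≤ d) {I J : Finset (Fin n)} (hI : 0 < I.card) (hJ : 0 < J.card)
    (c : ℝ) :
    μ.real {ω | ¬ (blockSum (A ω) I J ≤ Real.exp 2 * (d * I.card * J.card / n) ∨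
      blockSum (A ω) I J * Real.log (blockSum (A ω) I J / (d * I.card * J.card / n)) ≤
        c * entropyWeight n J.card)} ≤
      (n ^ 2 + 1) * Real.exp (-(c * entropyWeight n J.card / 4)) := by
  set ν : ℝ := d * I.card * J.card / n with hν
  set R := Finset.range (n ^ 2 + 1) with hR
  set R' := R.filter fun k : ℕ => Real.exp 2 * ν ≤ k ∧
    c * entropyWeight n J.card ≤ k * Real.log (k / ν) with hR'
  have hsub : {ω | ¬ (blockSum (A ω) I J ≤ Real.exp 2 * ν ∨
      blockSum (A ω) I J * Real.log (blockSum (A ω) I J / ν) ≤ c * entropyWeight n J.card)} ⊆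
      ⋃ k ∈ R', {ω | (k : ℝ) ≤ blockSum (A ω) I J} := by
    intro ω hω
    simp only [Set.mem_ofPred_eq, not_or, not_le] at hω
    obtain ⟨k, hk, hkω⟩ := h.exists_nat_blockSum_eq ω I J
    rw [hkω] at hω
    simp only [Set.mem_iUnion]
    exact ⟨k, Finset.mem_filter.2 ⟨hk, hω.1.le, hω.2.le⟩, hkω.ge⟩
  refine (measureReal_mono hsub (measure_ne_top _ _)).trans ((measureReal_biUnion_finset_le _ _).trans ?_)
  calc ∑ k ∈ R', μ.real {ω | (k : ℝ) ≤ blockSum (A ω) I J}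
      ≤ ∑ k ∈ R', Real.exp (-(c * entropyWeight n J.card / 4)) := by
        refine Finset.sum_le_sum fun k hk => ?_
        obtain ⟨-, hk1, hk2⟩ := Finset.mem_filter.1 hk
        refine (h.prob_blockSum_ge_le hd hp hI hJ hk1).trans (Real.exp_le_exp.2 ?_)
        rw [← hν]
        linarith
    _ = R'.card * Real.exp (-(c * entropyWeight n J.card / 4)) := by simp
    _ ≤ _ := by
        gcongr
        have : R'.card ≤ n ^ 2 + 1 := (Finset.card_filter_le _ _).trans (by simp [hR])
        exact_mod_cast this

/-- The adjacency matrix has the discrepancy property with high probability. -/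
theorem prob_not_hasDiscrepancy_le (h : IsInhomogeneousER μ p A) {d : ℝ} (hd : 0 < d)
    (hn : 0 < n) (hp : ∀ i j, n * p i j ≤ d) {r : ℝ} (hr : 1 ≤ r) :
    μ.real {ω | ¬ HasDiscrepancy d (24 * r) (A ω)} ≤ (n : ℝ) ^ (-r) / 2 := by
  have hn' : (0 : ℝ) < n := by exact_mod_cast hn
  have hn1 : (1 : ℝ) ≤ n := by exact_mod_cast hn
  have hlog : 0 ≤ Real.log n := Real.log_nonneg hn1
  set F : ℕ → Finset (Finset (Fin n)) := fun m => Finset.univ.filter fun I => I.card ≤ m with hF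
  set P : ℕ → Finset (Finset (Fin n) × Finset (Fin n)) := fun m =>
    (F m ×ˢ F m).filter fun q => 0 < q.1.card ∧ q.2.card = m with hP
  set B : Finset (Fin n) × Finset (Fin n) → Set Ω := fun q =>
    {ω | ¬ (blockSum (A ω) q.1 q.2 ≤ Real.exp 2 * (d * q.1.card * q.2.card / n) ∨
      blockSum (A ω) q.1 q.2 * Real.log (blockSum (A ω) q.1 q.2 / (d * q.1.card * q.2.card / n)) ≤
        24 * r * entropyWeight n q.2.card)} with hB
  have hsub : {ω | ¬ HasDiscrepancy d (24 * r) (A ω)} ⊆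
      ⋃ m ∈ Finset.Icc 1 n, ⋃ q ∈ P m, B q := by
    intro ω hω
    simp only [Set.mem_ofPred_eq, HasDiscrepancy, not_forall] at hω
    obtain ⟨I, J, hI, hIJ, hω⟩ := hω
    simp only [Set.mem_iUnion]
    refine ⟨J.card, Finset.mem_Icc.2 ⟨by omega, by simpa using J.card_le_univ⟩, (I, J), ?_, hω⟩
    simpa [hP, hF, hIJ] using hI
  -- Since `|I| ≤ |J| = m`, there are at most `e ^ (2 W)` pairs, where `W` is the entropy weight.
  -- The constant `24 r` gives the decay `e ^ (-6 r W)`, and `6 r - 2 ≥ r + 3`; the spare `n ^ (-3)`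
  -- pays for the values of `m` and of the block sum.
  have hm : ∀ m ∈ Finset.Icc 1 n, μ.real (⋃ q ∈ P m, B q) ≤
      (n ^ 2 + 1) * Real.exp (-((r + 3) * (1 + Real.log n))) := by
    intro m hm
    obtain ⟨hm1, hmn⟩ := Finset.mem_Icc.1 hm
    have hW := one_add_log_le_entropyWeight hm1 hmn
    have hc := card_filter_card_le_exp_entropyWeight hm1 hmn
    have hPc : ((P m).card : ℝ) ≤ Real.exp (2 * entropyWeight n m) := by
      calc ((P m).card : ℝ) ≤ ((F m ×ˢ F m).card : ℝ) := by
            exact_mod_cast Finset.card_filter_le _ _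
        _ = (F m).card * (F m).card := by rw [Finset.card_product]; push_cast; rfl
        _ ≤ Real.exp (entropyWeight n m) * Real.exp (entropyWeight n m) := by gcongr
        _ = _ := by rw [← Real.exp_add]; congr 1; ring
    calc μ.real (⋃ q ∈ P m, B q) ≤ ∑ q ∈ P m, μ.real (B q) := measureReal_biUnion_finset_le _ _
      _ ≤ ∑ q ∈ P m, (n ^ 2 + 1) * Real.exp (-(24 * r * entropyWeight n m / 4)) := by
          refine Finset.sum_le_sum fun q hq => ?_
          obtain ⟨-, hq1, hq2⟩ := Finset.mem_filter.1 hq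
          have := h.prob_not_discrepancy_block_le hd hp hq1 (by omega) (24 * r) (J := q.2)
          simpa only [hB, hq2] using this
      _ = (P m).card * ((n ^ 2 + 1) * Real.exp (-(24 * r * entropyWeight n m / 4))) := by simp
      _ ≤ Real.exp (2 * entropyWeight n m) *
          ((n ^ 2 + 1) * Real.exp (-(24 * r * entropyWeight n m / 4))) := by gcongr
      _ = (n ^ 2 + 1) * Real.exp (-((6 * r - 2) * entropyWeight n m)) := by
          rw [mul_left_comm, ← Real.exp_add]; congr 2; ring
      _ ≤ _ := by
          gcongr <;> linarith
  refine (measureReal_mono hsub (measure_ne_top _ _)).trans ((measureReal_biUnion_finset_le _ _).trans ?_)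
  refine (Finset.sum_le_sum hm).trans ?_
  rw [Finset.sum_const, Nat.card_Icc, nsmul_eq_mul, Nat.add_sub_cancel]
  have e1 : Real.exp (-((r + 3) * (1 + Real.log n))) =
      Real.exp (-(r + 3)) * ((n : ℝ) ^ (-r) * ((n : ℝ) ^ 3)⁻¹) := by
    rw [Real.rpow_def_of_pos hn', ← Real.exp_log (pow_pos hn' 3), ← Real.exp_neg, ← Real.exp_add,
      ← Real.exp_add, Real.log_pow]
    congr 1; push_cast; ring
  have e2 : Real.exp (-(r + 3)) ≤ 1 / 4 := by
    rw [Real.exp_neg, one_div]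
    gcongr
    linarith [Real.add_one_le_exp (r + 3)]
  have hpos : 0 ≤ (n : ℝ) ^ (-r) := Real.rpow_nonneg hn'.le _
  rw [e1]
  calc (n : ℝ) * ((n ^ 2 + 1) * (Real.exp (-(r + 3)) * ((n : ℝ) ^ (-r) * ((n : ℝ) ^ 3)⁻¹)))
      ≤ n * ((n ^ 2 + n ^ 2) * (1 / 4 * ((n : ℝ) ^ (-r) * ((n : ℝ) ^ 3)⁻¹))) := by
        gcongr
        exact one_le_pow₀ hn1
    _ = _ := by field_simp; norm_num

end IsInhomogeneousER

/-! ### Heavy pairs: dyadic decomposition. -/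

/-- The identity, cut to zero above `4`. -/
noncomputable def cutoff (z : ℝ) : ℝ := if z ≤ 4 then z else 0

theorem cutoff_nonneg {z : ℝ} (hz : 0 ≤ z) : 0 ≤ cutoff z := by
  unfold cutoff; split_ifs <;> simp [hz]

theorem cutoff_of_le {z : ℝ} (hz : z ≤ 4) : cutoff z = z := if_pos hz

theorem sum_two_zpow_le (F : Finset ℤ) :
    ∀ m : ℤ, (∀ s ∈ F, s ≤ m) → ∑ s ∈ F, (2 : ℝ) ^ s ≤ 2 ^ (m + 1) := by
  induction F using Finset.induction_on_max with
  | empty => intro m _; simpa using (zpow_pos (by norm_num : (0 : ℝ) < 2) (m + 1)).le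
  | insert a s hs ih =>
    intro m hm
    rw [Finset.sum_insert (fun h => (hs a h).false)]
    have h1 := ih (a - 1) fun x hx => by have := hs x hx; omega
    have h2 : (2 : ℝ) ^ a ≤ 2 ^ m :=
      zpow_le_zpow_right₀ (by norm_num) (hm a (Finset.mem_insert_self _ _))
    rw [sub_add_cancel] at h1
    rw [zpow_add_one₀ (by norm_num)]
    linarith

/-- The surviving terms are dominated by a geometric series whose largest term is at most `4`. -/
theorem sum_cutoff_two_zpow_le {κ : ℝ} (hκ : 0 < κ) (F : Finset ℤ) :
    ∑ s ∈ F, cutoff (κ * 2 ^ s) ≤ 8 := by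
  unfold cutoff
  rw [← Finset.sum_filter]
  set G := F.filter fun s : ℤ => κ * 2 ^ s ≤ 4 with hG
  rcases G.eq_empty_or_nonempty with h | h
  · simp [h]
  · have h1 := sum_two_zpow_le G (G.max' h) fun s hs => G.le_max' s hs
    have h2 := (Finset.mem_filter.1 (G.max'_mem h)).2
    rw [zpow_add_one₀ (by norm_num)] at h1
    rw [← Finset.mul_sum]
    nlinarith

theorem sum_cutoff_two_zpow_neg_le {κ : ℝ} (hκ : 0 < κ) (F : Finset ℤ) :
    ∑ s ∈ F, cutoff (κ * 2 ^ (-s)) ≤ 8 := by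
  have := sum_cutoff_two_zpow_le hκ (F.image Neg.neg)
  rwa [Finset.sum_image neg_injective.injOn] at this

set_option maxHeartbeats 800000 in
/-- The contribution of one dyadic block `I × J` with `|I| = a ≤ |J| = b`, total weight `E`, and
vector entries of size `u / √N` on `I` and `v / √N` on `J`. -/
theorem dyadic_block_le {N a b u v w E c : ℝ} (hN : 0 < N) (ha : 0 < a) (hb : 0 < b) (hu : 0 < u)
    (hv : 0 < v) (hw : 0 < w) (hc : 1 ≤ c)
    (hheavy : w ≤ 4 * (u * v)) (hdeg : E ≤ 2 * w ^ 2 * a)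
    (hdisc : E ≤ Real.exp 2 * (w ^ 2 * a * b / N) ∨
      E * Real.log (E / (w ^ 2 * a * b / N)) ≤ c * (b * (1 + Real.log (N / b)))) :
    u * v * E / N ≤ 32 * c * w * ((a * u ^ 2 / N) * (b * v ^ 2 / N)
      + (a * u ^ 2 / N) * cutoff (w * v / u) + (b * v ^ 2 / N) * cutoff (u / (v * w))
      + (b * v ^ 2 / N) * cutoff (u / w) + (a * u ^ 2 / N) * cutoff (w / (u * v))) := by
  set α := a * u ^ 2 / N with hα
  set β := b * v ^ 2 / N with hβd
  have hα0 : 0 < α := by positivity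
  have hβ0 : 0 < β := by positivity
  have n1 : 0 ≤ α * β := by positivity
  have n2 : 0 ≤ α * cutoff (w * v / u) := mul_nonneg hα0.le (cutoff_nonneg (by positivity))
  have n3 : 0 ≤ β * cutoff (u / (v * w)) := mul_nonneg hβ0.le (cutoff_nonneg (by positivity))
  have n4 : 0 ≤ β * cutoff (u / w) := mul_nonneg hβ0.le (cutoff_nonneg (by positivity))
  have n5 : 0 ≤ α * cutoff (w / (u * v)) := mul_nonneg hα0.le (cutoff_nonneg (by positivity))
  have key : ∀ X : ℝ, 0 ≤ X → u * v * E / N ≤ 32 * c * w * X →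
      X ≤ α * β + α * cutoff (w * v / u) + β * cutoff (u / (v * w))
        + β * cutoff (u / w) + α * cutoff (w / (u * v)) →
      u * v * E / N ≤ 32 * c * w * (α * β + α * cutoff (w * v / u) + β * cutoff (u / (v * w))
        + β * cutoff (u / w) + α * cutoff (w / (u * v))) := by
    intro X _ h1 h2
    exact h1.trans (mul_le_mul_of_nonneg_left h2 (by positivity))
  have hcw : w ≤ c * w := le_mul_of_one_le_left hw.le hc
  have he2 : Real.exp 2 ≤ 8 := by
    have : Real.exp 2 = Real.exp 1 ^ 2 := by rw [← Real.exp_nat_mul]; norm_num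
    rw [this]
    nlinarith [Real.exp_one_lt_d9, Real.exp_pos 1]
  set ν := w ^ 2 * a * b / N with hν
  have hν0 : 0 < ν := by positivity
  -- the factorisation behind all the estimates
  have hfac : u * v * ν / N = w * (α * β) * (w / (u * v)) := by
    rw [hν, hα, hβd]; field_simp
  have hwuv : w / (u * v) ≤ 4 := by rw [div_le_iff₀ (by positivity)]; exact hheavy
  -- Ordinary density: `e² ≤ 8` and `w / (u v) ≤ 4` produce the constant `32`.
  by_cases hsmall : E ≤ Real.exp 2 * ν
  · refine key _ n1 ?_ (by linarith)
    calc u * v * E / N ≤ u * v * (8 * ν) / N := by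
          gcongr
          exact hsmall.trans (by gcongr)
      _ = 8 * (u * v * ν / N) := by ring
      _ = 8 * (w * (α * β) * (w / (u * v))) := by rw [hfac]
      _ ≤ 8 * (w * (α * β) * 4) := by gcongr
      _ = 32 * w * (α * β) := by ring
      _ ≤ 32 * c * w * (α * β) := by rw [mul_assoc 32 c]; gcongr
  have hdisc := hdisc.resolve_left hsmall
  rw [not_le] at hsmall
  have hE0 : 0 < E := (by positivity : 0 < Real.exp 2 * ν).trans hsmall
  set l := E / ν with hl
  have hl0 : 0 < l := by positivity
  have hlog2 : 2 ≤ Real.log l := by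
    rw [Real.le_log_iff_exp_le hl0, hl, le_div_iff₀ hν0]
    exact hsmall.le
  have hEl : E = l * ν := by rw [hl]; field_simp
  have hterm : u * v * E / N = w * (α * β) * (w / (u * v)) * l := by
    rw [← hfac, hEl]; ring
  -- Here the degree bound on `E` alone suffices.
  by_cases hdegcase : w * v / u ≤ 1
  · refine key _ n2 ?_ (by linarith)
    rw [cutoff_of_le (by linarith)]
    calc u * v * E / N ≤ u * v * (2 * w ^ 2 * a) / N := by gcongr
      _ = 2 * w * (α * (w * v / u)) := by rw [hα]; field_simp
      _ ≤ 2 * (c * w) * (α * (w * v / u)) := by gcongr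
      _ ≤ 32 * c * w * (α * (w * v / u)) := by
          rw [mul_assoc 32 c]; gcongr; norm_num
  rw [not_le, one_lt_div hu] at hdegcase
  have hL : 1 + Real.log (N / b) = 1 + 2 * Real.log v + Real.log (1 / β) := by
    have : N / b = v ^ 2 * (1 / β) := by rw [hβd]; field_simp
    rw [this, Real.log_mul (by positivity) (by positivity), Real.log_pow]
    push_cast; ring
  -- If `log l` is at least a quarter of the entropy factor, the discrepancy bound loses its
  -- logarithm: `E ≤ 4 c b`.
  by_cases hlarge : 1 + Real.log (N / b) ≤ 4 * Real.log l
  · refine key _ n3 ?_ (by linarith)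
    have h1 : u / (v * w) ≤ 1 := by
      rw [div_le_one (by positivity)]; linarith
    rw [cutoff_of_le (by linarith)]
    have h2 : E ≤ 4 * c * b := by
      have : E * Real.log l ≤ 4 * c * b * Real.log l :=
        hdisc.trans (by
          have : c * (b * (1 + Real.log (N / b))) ≤ c * (b * (4 * Real.log l)) := by gcongr
          linarith)
      exact le_of_mul_le_mul_right this (by linarith)
    calc u * v * E / N ≤ u * v * (4 * c * b) / N := by gcongr
      _ = 4 * (c * w) * (β * (u / (v * w))) := by rw [hβd]; field_simp
      _ ≤ 32 * c * w * (β * (u / (v * w))) := by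
          rw [mul_assoc 32 c]; gcongr; norm_num
  rw [not_le, hL] at hlarge
  -- Now `log l` is small against the entropy, which splits through `N / b = v² / β`. If the part
  -- from `v` dominates, then `l ≤ √e v`, and `log l ≥ 2` still lets discrepancy give `E ≤ 2 c b v`.
  -- If `1 / β` dominates, then `β l ≤ 1` cancels the density excess `l`.
  by_cases hcmp : Real.log (1 / β) ≤ 1 + 2 * Real.log v
  · have h1 : 2 * Real.log l ≤ 1 + 2 * Real.log v := by linarith
    by_cases hσ : l * w ≤ u * v
    · refine key _ n1 ?_ (by linarith)
      rw [hterm]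
      calc w * (α * β) * (w / (u * v)) * l = w * (α * β) * ((l * w) / (u * v)) := by ring
        _ ≤ w * (α * β) * 1 := by
            gcongr; rw [div_le_one (by positivity)]; exact hσ
        _ ≤ 32 * c * w * (α * β) := by
            rw [mul_assoc 32 c, mul_one]; gcongr; linarith
    · rw [not_le] at hσ
      refine key _ n4 ?_ (by linarith)
      have hl2 : l ≤ 2 * v := by
        have : Real.log l ≤ Real.log (2 * v) := by
          rw [Real.log_mul (by norm_num) hv.ne']
          linarith [Real.log_two_gt_d9]
        exact (Real.log_le_log_iff hl0 (by positivity)).1 this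
      have hu2 : u ≤ 2 * w := by
        have : u * v ≤ 2 * w * v :=
          calc u * v ≤ l * w := hσ.le
            _ ≤ 2 * v * w := by gcongr
            _ = 2 * w * v := by ring
        exact le_of_mul_le_mul_right this hv
      have h3 : u / w ≤ 4 := by rw [div_le_iff₀ hw]; linarith
      rw [cutoff_of_le h3]
      have h4 : E ≤ 2 * c * b * v := by
        have hlv := Real.log_le_sub_one_of_pos hv
        have h5 : c * (b * (1 + Real.log (N / b))) ≤ c * (b * (4 * v)) := by
          gcongr
          linarith
        have h6 : E * 2 ≤ E * Real.log l := by gcongr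
        linarith
      calc u * v * E / N ≤ u * v * (2 * c * b * v) / N := by gcongr
        _ = 2 * (c * w) * (β * (u / w)) := by rw [hβd]; field_simp
        _ ≤ 32 * c * w * (β * (u / w)) := by
            rw [mul_assoc 32 c]; gcongr; norm_num
  · rw [not_le] at hcmp
    refine key _ n5 ?_ (by linarith)
    rw [cutoff_of_le hwuv, hterm]
    have h1 : β * l ≤ 1 := by
      have h2 : Real.log l ≤ Real.log (1 / β) := by linarith
      have := (Real.log_le_log_iff hl0 (by positivity)).1 h2
      rw [le_div_iff₀ hβ0] at this
      linarith
    calc w * (α * β) * (w / (u * v)) * l = w * (α * (w / (u * v))) * (β * l) := by ring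
      _ ≤ w * (α * (w / (u * v))) * 1 := by gcongr
      _ ≤ 32 * c * w * (α * (w / (u * v))) := by
          rw [mul_assoc 32 c, mul_one]; gcongr; linarith

/-- The dyadic level of the entry `x i`, on the scale `1 / √n`. -/
noncomputable def dyadicLevel {n : ℕ} (x : Fin n → ℝ) (i : Fin n) : ℤ := Int.log 2 (|x i| * √n)

/-- The set of nonzero entries of `x` with given dyadic level. -/
noncomputable def levelSet {n : ℕ} (x : Fin n → ℝ) (s : ℤ) : Finset (Fin n) :=
  -- Zero entries must be excluded by hand, since `Int.log` gives them the default level `0`.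
  Finset.univ.filter fun i => x i ≠ 0 ∧ dyadicLevel x i = s

section Level

variable {n : ℕ} {x : Fin n → ℝ}

theorem mem_levelSet {s : ℤ} {i : Fin n} : i ∈ levelSet x s ↔ x i ≠ 0 ∧ dyadicLevel x i = s := by
  simp [levelSet]

theorem two_zpow_dyadicLevel_le {i : Fin n} (hi : x i ≠ 0) :
    (2 : ℝ) ^ dyadicLevel x i ≤ |x i| * √n := by
  have hn : (0 : ℝ) < n := by exact_mod_cast i.pos
  have := Int.zpow_log_le_self (b := 2) (by norm_num)
    (mul_pos (abs_pos.2 hi) (Real.sqrt_pos.2 hn))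
  exact_mod_cast this

theorem lt_two_zpow_dyadicLevel (i : Fin n) : |x i| * √n < 2 * (2 : ℝ) ^ dyadicLevel x i := by
  have := Int.lt_zpow_succ_log_self (b := 2) (by norm_num) (|x i| * √n)
  rw [Nat.cast_ofNat, zpow_add_one₀ (by norm_num)] at this
  rw [mul_comm 2]
  exact this

/-- Each nonzero coordinate lies in exactly one level and its square is at least `(2 ^ s)² / n`, so
the level masses form a subprobability. -/
theorem sum_card_levelSet_le (hx : ∑ i, x i ^ 2 ≤ 1) (F : Finset ℤ) :
    ∑ s ∈ F, (levelSet x s).card * ((2 : ℝ) ^ s) ^ 2 / n ≤ 1 := by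
  have h1 : ∀ s ∈ F, (levelSet x s).card * ((2 : ℝ) ^ s) ^ 2 / n ≤
      ∑ i, if x i ≠ 0 ∧ dyadicLevel x i = s then x i ^ 2 else 0 := by
    intro s _
    rw [← Finset.sum_filter, mul_div_assoc, ← nsmul_eq_mul, ← Finset.sum_const]
    refine Finset.sum_le_sum fun i hi => ?_
    obtain ⟨hi0, rfl⟩ := mem_levelSet.1 hi
    have hn : (0 : ℝ) < n := by exact_mod_cast i.pos
    rw [div_le_iff₀ hn, ← sq_abs (x i)]
    calc ((2 : ℝ) ^ dyadicLevel x i) ^ 2 ≤ (|x i| * √n) ^ 2 := by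
          gcongr; exact two_zpow_dyadicLevel_le hi0
      _ = |x i| ^ 2 * n := by rw [mul_pow, Real.sq_sqrt hn.le]
  refine (Finset.sum_le_sum h1).trans ?_
  rw [Finset.sum_comm]
  refine le_trans (Finset.sum_le_sum fun i _ => ?_) hx
  simp only [ite_and, Finset.sum_ite_irrel, Finset.sum_ite_eq, Finset.sum_const_zero]
  split_ifs <;> first | exact le_rfl | exact sq_nonneg _

end Level

/-- Heavy pairs `(i, j)` whose row level set is at most as large as the column level set. -/
theorem sum_heavy_row_le {n : ℕ} {d c : ℝ} (hd : 0 < d) (hc : 1 ≤ c)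
    {M : Matrix (Fin n) (Fin n) ℝ} (hM : ∀ i j, 0 ≤ M i j) (hdeg : ∀ i, ∑ j, M i j ≤ 2 * d)
    (hdisc : HasDiscrepancy d c M) {x y : Fin n → ℝ} (hx : ∑ i, x i ^ 2 ≤ 1)
    (hy : ∑ i, y i ^ 2 ≤ 1) :
    ∑ i, ∑ j, (if √d / n < |x i * y j| ∧ (levelSet x (dyadicLevel x i)).card ≤
      (levelSet y (dyadicLevel y j)).card then |x i * y j| * M i j else 0) ≤ 4224 * c * √d := by
  rcases Nat.eq_zero_or_pos n with rfl | hn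
  · simp only [Finset.univ_eq_empty, Finset.sum_empty]; positivity
  have hn' : (0 : ℝ) < n := by exact_mod_cast hn
  have hw : 0 < √d := Real.sqrt_pos.2 hd
  set w := √d with hwd
  have hw2 : d = w ^ 2 := (Real.sq_sqrt hd.le).symm
  set Q : Finset (Fin n × Fin n) := Finset.univ.filter fun q => w / n < |x q.1 * y q.2| ∧
    (levelSet x (dyadicLevel x q.1)).card ≤ (levelSet y (dyadicLevel y q.2)).card with hQ
  set F := Finset.univ.image (dyadicLevel x) with hF
  set G := Finset.univ.image (dyadicLevel y) with hG
  set α : ℤ → ℝ := fun s => (levelSet x s).card * ((2 : ℝ) ^ s) ^ 2 / n with hα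
  set β : ℤ → ℝ := fun t => (levelSet y t).card * ((2 : ℝ) ^ t) ^ 2 / n with hβ
  have hα0 : ∀ s, 0 ≤ α s := fun s =>
    div_nonneg (mul_nonneg (Nat.cast_nonneg _) (sq_nonneg _)) (Nat.cast_nonneg _)
  have hβ0 : ∀ t, 0 ≤ β t := fun t =>
    div_nonneg (mul_nonneg (Nat.cast_nonneg _) (sq_nonneg _)) (Nat.cast_nonneg _)
  have hα1 : ∑ s ∈ F, α s ≤ 1 := sum_card_levelSet_le hx F
  have hβ1 : ∑ t ∈ G, β t ≤ 1 := sum_card_levelSet_le hy G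
  have hpow : ∀ s : ℤ, (0 : ℝ) < 2 ^ s := fun s => zpow_pos (by norm_num) s
  set Φ : ℤ → ℤ → ℝ := fun s t => α s * β t + α s * cutoff (w / 2 ^ s * 2 ^ t)
    + β t * cutoff (1 / (2 ^ t * w) * 2 ^ s) + β t * cutoff (1 / w * 2 ^ s)
    + α s * cutoff (w / 2 ^ s * 2 ^ (-t)) with hΦ
  have hΦ0 : ∀ s t, 0 ≤ Φ s t := by
    intro s t
    have := hpow s
    have := hpow t
    have := hpow (-t)
    have h1 := mul_nonneg (hα0 s) (hβ0 t)
    have h2 := mul_nonneg (hα0 s) (cutoff_nonneg (z := w / 2 ^ s * 2 ^ t) (by positivity))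
    have h3 := mul_nonneg (hβ0 t) (cutoff_nonneg (z := 1 / (2 ^ t * w) * 2 ^ s) (by positivity))
    have h4 := mul_nonneg (hβ0 t) (cutoff_nonneg (z := 1 / w * 2 ^ s) (by positivity))
    have h5 := mul_nonneg (hα0 s) (cutoff_nonneg (z := w / 2 ^ s * 2 ^ (-t)) (by positivity))
    simp only [hΦ]
    linarith
  have hupper : ∀ i j, |x i * y j| ≤ 4 * (2 ^ dyadicLevel x i * 2 ^ dyadicLevel y j) / n := by
    intro i j
    rw [le_div_iff₀ hn', abs_mul]
    have h1 := (lt_two_zpow_dyadicLevel (x := x) i).le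
    have h2 := (lt_two_zpow_dyadicLevel (x := y) j).le
    calc |x i| * |y j| * n = (|x i| * √n) * (|y j| * √n) := by
          rw [mul_mul_mul_comm, Real.mul_self_sqrt hn'.le]
      _ ≤ (2 * 2 ^ dyadicLevel x i) * (2 * 2 ^ dyadicLevel y j) := by gcongr
      _ = _ := by ring
  have hfiber : ∀ st ∈ F ×ˢ G,
      ∑ q ∈ Q with (dyadicLevel x q.1, dyadicLevel y q.2) = st, |x q.1 * y q.2| * M q.1 q.2
        ≤ 128 * c * w * Φ st.1 st.2 := by
    rintro ⟨s, t⟩ -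
    rcases (Q.filter fun q => (dyadicLevel x q.1, dyadicLevel y q.2) = (s, t)).eq_empty_or_nonempty
      with h | ⟨q₀, hq₀⟩
    · rw [h, Finset.sum_empty]
      exact mul_nonneg (mul_nonneg (by linarith) hw.le) (hΦ0 s t)
    · have hne : ∀ q : Fin n × Fin n, w / n < |x q.1 * y q.2| → x q.1 ≠ 0 ∧ y q.2 ≠ 0 := by
        intro q hq
        have : x q.1 * y q.2 ≠ 0 := abs_pos.1 ((by positivity : 0 < w / n).trans hq)
        exact mul_ne_zero_iff.1 this
      simp only [hQ, Finset.mem_filter, Finset.mem_univ, true_and, Prod.mk.injEq] at hq₀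
      obtain ⟨⟨hheavy, hcard⟩, hs, ht⟩ := hq₀
      have hmemI : q₀.1 ∈ levelSet x s := mem_levelSet.2 ⟨(hne _ hheavy).1, hs⟩
      have hmemJ : q₀.2 ∈ levelSet y t := mem_levelSet.2 ⟨(hne _ hheavy).2, ht⟩
      have hI : 0 < (levelSet x s).card := Finset.card_pos.2 ⟨_, hmemI⟩
      have hJ : 0 < (levelSet y t).card := Finset.card_pos.2 ⟨_, hmemJ⟩
      -- One heavy pair in the block already forces `w ≤ 4 u v` for its levels.
      have hup0 := hheavy.trans_le (hupper q₀.1 q₀.2)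
      rw [hs, ht] at hcard hup0
      rw [div_lt_div_iff_of_pos_right hn'] at hup0
      set E := blockSum M (levelSet x s) (levelSet y t) with hE
      have hEdeg : E ≤ 2 * w ^ 2 * (levelSet x s).card := by
        calc E ≤ ∑ i ∈ levelSet x s, 2 * d := by
              refine Finset.sum_le_sum fun i _ => le_trans ?_ (hdeg i)
              exact Finset.sum_le_univ_sum_of_nonneg (hM i)
          _ = _ := by rw [Finset.sum_const, nsmul_eq_mul, hw2]; ring
      have hblock := dyadic_block_le hn' (a := (levelSet x s).card) (b := (levelSet y t).card)
        (by exact_mod_cast hI) (by exact_mod_cast hJ) (hpow s) (hpow t) hw hc hup0.le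
        hEdeg (by
          have := hdisc _ _ hI hcard
          rw [hw2] at this
          exact this)
      have hle : ∑ q ∈ Q with (dyadicLevel x q.1, dyadicLevel y q.2) = (s, t),
          |x q.1 * y q.2| * M q.1 q.2 ≤ 4 * (2 ^ s * 2 ^ t * E / n) := by
        calc ∑ q ∈ Q with (dyadicLevel x q.1, dyadicLevel y q.2) = (s, t),
              |x q.1 * y q.2| * M q.1 q.2
            ≤ ∑ q ∈ Q with (dyadicLevel x q.1, dyadicLevel y q.2) = (s, t),
              4 * ((2 : ℝ) ^ s * 2 ^ t) / n * M q.1 q.2 := by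
              refine Finset.sum_le_sum fun q hq => ?_
              have h1 := (Finset.mem_filter.1 hq).2
              rw [Prod.mk.injEq] at h1
              have h2 := hupper q.1 q.2
              rw [h1.1, h1.2] at h2
              exact mul_le_mul_of_nonneg_right h2 (hM _ _)
          _ ≤ ∑ q ∈ levelSet x s ×ˢ levelSet y t,
              4 * ((2 : ℝ) ^ s * 2 ^ t) / n * M q.1 q.2 := by
              refine Finset.sum_le_sum_of_subset_of_nonneg ?_ fun q _ _ => ?_
              · intro q hq
                simp only [hQ, Finset.mem_filter, Finset.mem_univ, true_and,
                  Prod.mk.injEq] at hq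
                exact Finset.mem_product.2 ⟨mem_levelSet.2 ⟨(hne _ hq.1.1).1, hq.2.1⟩,
                  mem_levelSet.2 ⟨(hne _ hq.1.1).2, hq.2.2⟩⟩
              · have := hM q.1 q.2
                have := hpow s
                have := hpow t
                positivity
          _ = _ := by
              rw [← Finset.mul_sum, Finset.sum_product, hE, blockSum]; ring
      have hΦe : Φ s t = ((levelSet x s).card * (2 ^ s) ^ 2 / n) *
            ((levelSet y t).card * (2 ^ t) ^ 2 / n)
          + ((levelSet x s).card * (2 ^ s) ^ 2 / n) * cutoff (w * 2 ^ t / 2 ^ s)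
          + ((levelSet y t).card * (2 ^ t) ^ 2 / n) * cutoff (2 ^ s / (2 ^ t * w))
          + ((levelSet y t).card * (2 ^ t) ^ 2 / n) * cutoff (2 ^ s / w)
          + ((levelSet x s).card * (2 ^ s) ^ 2 / n) * cutoff (w / (2 ^ s * 2 ^ t)) := by
        simp only [hΦ, hα, hβ]
        rw [zpow_neg, div_mul_eq_mul_div w, one_div_mul_eq_div, one_div_mul_eq_div, ← div_div w,
          div_eq_mul_inv (w / 2 ^ s)]
      rw [← hΦe] at hblock
      refine hle.trans ?_
      show _ ≤ 128 * c * w * Φ s t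
      linarith
  -- The product term gives `1`; each of the four others is a subprobability against a cutoff series
  -- bounded by `8`.
  have hsumΦ : ∑ st ∈ F ×ˢ G, Φ st.1 st.2 ≤ 33 := by
    rw [Finset.sum_product]
    simp only [hΦ, Finset.sum_add_distrib]
    have s1 : ∑ s ∈ F, ∑ t ∈ G, α s * β t ≤ 1 := by
      rw [← Finset.sum_mul_sum]
      exact mul_le_one₀ hα1 (Finset.sum_nonneg fun t _ => hβ0 t) hβ1
    have aux : ∀ (K : Finset ℤ) (γ : ℤ → ℝ) (H : Finset ℤ) (f : ℤ → ℤ → ℝ), (∀ s, 0 ≤ γ s) →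
        ∑ s ∈ K, γ s ≤ 1 → (∀ s, ∑ t ∈ H, f s t ≤ 8) → ∑ s ∈ K, ∑ t ∈ H, γ s * f s t ≤ 8 := by
      intro K γ H f h0 h1 h2
      calc ∑ s ∈ K, ∑ t ∈ H, γ s * f s t ≤ ∑ s ∈ K, γ s * 8 := by
            refine Finset.sum_le_sum fun s _ => ?_
            rw [← Finset.mul_sum]
            exact mul_le_mul_of_nonneg_left (h2 s) (h0 s)
        _ = (∑ s ∈ K, γ s) * 8 := by rw [Finset.sum_mul]
        _ ≤ 8 := by linarith
    have s2 := aux F α G (fun s t => cutoff (w / 2 ^ s * 2 ^ t)) hα0 hα1 fun s =>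
      sum_cutoff_two_zpow_le (div_pos hw (hpow s)) G
    have s3 := aux G β F (fun t s => cutoff (1 / (2 ^ t * w) * 2 ^ s)) hβ0 hβ1 fun t =>
      sum_cutoff_two_zpow_le (one_div_pos.2 (mul_pos (hpow t) hw)) F
    have s4 := aux G β F (fun t s => cutoff (1 / w * 2 ^ s)) hβ0 hβ1 fun t =>
      sum_cutoff_two_zpow_le (one_div_pos.2 hw) F
    have s5 := aux F α G (fun s t => cutoff (w / 2 ^ s * 2 ^ (-t))) hα0 hα1 fun s =>
      sum_cutoff_two_zpow_neg_le (div_pos hw (hpow s)) G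
    rw [Finset.sum_comm] at s3 s4
    linarith
  calc ∑ i, ∑ j, (if w / n < |x i * y j| ∧ (levelSet x (dyadicLevel x i)).card ≤
        (levelSet y (dyadicLevel y j)).card then |x i * y j| * M i j else 0)
      = ∑ q ∈ Q, |x q.1 * y q.2| * M q.1 q.2 := by
        rw [hQ, Finset.sum_filter, ← Finset.univ_product_univ, Finset.sum_product]
    _ = ∑ st ∈ F ×ˢ G, ∑ q ∈ Q with (dyadicLevel x q.1, dyadicLevel y q.2) = st,
          |x q.1 * y q.2| * M q.1 q.2 := by
        refine (Finset.sum_fiberwise_of_maps_to (fun q _ => ?_) _).symm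
        simp [hF, hG]
    _ ≤ ∑ st ∈ F ×ˢ G, 128 * c * w * Φ st.1 st.2 := Finset.sum_le_sum hfiber
    _ = 128 * c * w * ∑ st ∈ F ×ˢ G, Φ st.1 st.2 := by rw [Finset.mul_sum]
    _ ≤ 128 * c * w * 33 := by gcongr
    _ = 4224 * c * w := by ring

/-- The heavy pairs contribute `O(√d)` for a symmetric matrix with bounded degrees and small
discrepancy. -/
theorem sum_heavy_le {n : ℕ} {d c : ℝ} (hd : 0 < d) (hc : 1 ≤ c)
    {M : Matrix (Fin n) (Fin n) ℝ} (hsymm : M.IsSymm) (hM : ∀ i j, 0 ≤ M i j)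
    (hdeg : ∀ i, ∑ j, M i j ≤ 2 * d) (hdisc : HasDiscrepancy d c M) {x y : Fin n → ℝ}
    (hx : ∑ i, x i ^ 2 ≤ 1) (hy : ∑ i, y i ^ 2 ≤ 1) :
    ∑ i, ∑ j, (if √d / n < |x i * y j| then |x i * y j| * M i j else 0) ≤ 8448 * c * √d := by
  have h1 := sum_heavy_row_le hd hc hM hdeg hdisc hx hy
  -- Exchanging the vectors covers the pairs whose row level set is the larger one, by symmetry of
  -- `M`.
  have h2 := sum_heavy_row_le hd hc hM hdeg hdisc hy hx
  rw [Finset.sum_comm] at h2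
  refine le_trans ?_ ((add_le_add h1 h2).trans_eq (by ring))
  simp only [← Finset.sum_add_distrib]
  refine Finset.sum_le_sum fun i _ => Finset.sum_le_sum fun j _ => ?_
  rw [mul_comm (y j), hsymm.apply i j]
  have h0 : 0 ≤ |x i * y j| * M i j := mul_nonneg (abs_nonneg _) (hM i j)
  by_cases hh : √d / n < |x i * y j|
  · rcases le_total (levelSet x (dyadicLevel x i)).card (levelSet y (dyadicLevel y j)).card with
      hle | hle
    · simp only [hh, hle, and_self, if_true, true_and]
      split_ifs <;> linarith
    · simp only [hh, hle, and_self, if_true, true_and]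
      split_ifs <;> linarith
  · simp only [hh, false_and, if_false, add_zero, le_refl]

/-- The map `E ↦ E log (E / ν)` increases for `E ≥ ν`, and a block of `M'` above `e² ν` is also
above it in `M`. -/
theorem HasDiscrepancy.mono {n : ℕ} {d c : ℝ} (hd : 0 < d) {M M' : Matrix (Fin n) (Fin n) ℝ}
    (hM : HasDiscrepancy d c M) (hle : ∀ i j, M' i j ≤ M i j) : HasDiscrepancy d c M' := by
  intro I J hI hIJ
  have hn : (0 : ℝ) < n := by
    obtain ⟨i, -⟩ := Finset.card_pos.1 hI
    exact_mod_cast i.pos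
  have hI' : (0 : ℝ) < I.card := by exact_mod_cast hI
  have hJ' : (0 : ℝ) < J.card := by exact_mod_cast hI.trans_le hIJ
  have hsum : blockSum M' I J ≤ blockSum M I J :=
    Finset.sum_le_sum fun i _ => Finset.sum_le_sum fun j _ => hle i j
  by_cases h : blockSum M' I J ≤ Real.exp 2 * (d * I.card * J.card / n)
  · exact Or.inl h
  · right
    set ν := d * I.card * J.card / n with hν
    have hν0 : 0 < ν := by positivity
    have h1 := (hM I J hI hIJ).resolve_left fun h' => h (hsum.trans h')
    rw [not_le] at h
    have hpos : 0 < blockSum M' I J := (by positivity : 0 < Real.exp 2 * ν).trans h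
    refine le_trans ?_ h1
    refine mul_le_mul hsum (Real.log_le_log (by positivity) (by gcongr)) ?_
      (hpos.le.trans hsum)
    refine Real.log_nonneg ((one_le_div hν0).2 ?_)
    nlinarith [Real.add_one_le_exp 2]

/-! ### Nets and bilinear forms. -/

/-- The unit ball of a finite-dimensional space has a `1/2`-net of cardinality at most `5 ^ dim`. -/
theorem exists_half_net (E : Type*) [NormedAddCommGroup E] [NormedSpace ℝ E]
    [FiniteDimensional ℝ E] :
    ∃ N : Finset E, N.card ≤ 5 ^ Module.finrank ℝ E ∧ (∀ x ∈ N, ‖x‖ ≤ 1) ∧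
      ∀ v : E, ‖v‖ ≤ 1 → ∃ x ∈ N, ‖v - x‖ ≤ 1 / 2 := by
  classical
  by_contra! hcon
  -- Without a small net, `1`-separated sets in the ball of radius `2` could be extended greedily
  -- forever, against the packing bound `5 ^ dim`. Halving such a set gives the candidate net.
  have hall : ∀ k : ℕ, ∃ s : Finset E, s.card = k ∧ (∀ c ∈ s, ‖c‖ ≤ 2) ∧
      ∀ c ∈ s, ∀ d ∈ s, c ≠ d → 1 ≤ ‖c - d‖ := by
    intro k
    induction k with
    | zero => exact ⟨∅, by simp⟩
    | succ k ih =>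
      obtain ⟨s, hk, hs, hsep⟩ := ih
      obtain ⟨v, hv, hfar⟩ := hcon (s.image fun x => (1 / 2 : ℝ) • x)
        (Finset.card_image_le.trans (Besicovitch.card_le_of_separated s hs hsep))
        (by
          intro x hx
          obtain ⟨c, hc, rfl⟩ := Finset.mem_image.1 hx
          rw [norm_smul, Real.norm_of_nonneg (by norm_num)]
          linarith [hs c hc])
      have hfar' : ∀ c ∈ s, 1 < ‖(2 : ℝ) • v - c‖ := by
        intro c hc
        have h1 := hfar _ (Finset.mem_image_of_mem _ hc)
        have h2 : (2 : ℝ) • v - c = (2 : ℝ) • (v - (1 / 2 : ℝ) • c) := by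
          rw [smul_sub, smul_smul]; norm_num
        rw [h2, norm_smul, Real.norm_of_nonneg (by norm_num)]
        linarith
      have hnot : (2 : ℝ) • v ∉ s := by
        intro h
        have := hfar' _ h
        rw [sub_self, norm_zero] at this
        linarith
      refine ⟨insert ((2 : ℝ) • v) s, by rw [Finset.card_insert_of_notMem hnot, hk], ?_, ?_⟩
      · intro c hc
        rcases Finset.mem_insert.1 hc with rfl | hc
        · rw [norm_smul, Real.norm_of_nonneg (by norm_num)]; linarith
        · exact hs c hc
      · intro c hc c' hc' hne
        rcases Finset.mem_insert.1 hc with rfl | hc <;> rcases Finset.mem_insert.1 hc' with rfl | hc'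
        · exact absurd rfl hne
        · exact (hfar' c' hc').le
        · rw [norm_sub_rev]; exact (hfar' c hc).le
        · exact hsep c hc c' hc' hne
  obtain ⟨s, hk, hs, hsep⟩ := hall (5 ^ Module.finrank ℝ E + 1)
  have := Besicovitch.card_le_of_separated s hs hsep
  omega

/-- The operator norm is controlled by the bilinear form on a `1/2`-net. -/
theorem opNorm_le_of_half_net {E : Type*} [NormedAddCommGroup E] [InnerProductSpace ℝ E]
    {N : Finset E} (hN : ∀ v : E, ‖v‖ ≤ 1 → ∃ x ∈ N, ‖v - x‖ ≤ 1 / 2) (T : E →L[ℝ] E) {B : ℝ}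
    (hB0 : 0 ≤ B) (hB : ∀ x ∈ N, ∀ y ∈ N, inner ℝ x (T y) ≤ B) : ‖T‖ ≤ 4 * B := by
  have h1 : ∀ y ∈ N, ‖T y‖ ≤ 2 * B := by
    intro y hy
    set u := ‖T y‖⁻¹ • T y with hu
    have hu1 : ‖u‖ ≤ 1 := by
      rw [hu, norm_smul, norm_inv, norm_norm]
      exact inv_mul_le_one
    have hinner : inner ℝ u (T y) = ‖T y‖ := by
      rw [hu, real_inner_smul_left, real_inner_self_eq_norm_sq]
      rcases eq_or_ne ‖T y‖ 0 with h | h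
      · simp [h]
      · field_simp
    obtain ⟨x, hx, hux⟩ := hN u hu1
    have h2 : inner ℝ (u - x) (T y) ≤ 1 / 2 * ‖T y‖ :=
      (real_inner_le_norm _ _).trans (by gcongr)
    rw [inner_sub_left, hinner] at h2
    linarith [hB x hx y hy]
  have h2 : ‖T‖ ≤ 2 * B + 1 / 2 * ‖T‖ := by
    refine T.opNorm_le_of_unit_norm (by positivity) fun v hv => ?_
    obtain ⟨y, hy, hvy⟩ := hN v hv.le
    calc ‖T v‖ = ‖T y + T (v - y)‖ := by rw [← map_add, add_sub_cancel]
      _ ≤ ‖T y‖ + ‖T (v - y)‖ := norm_add_le _ _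
      _ ≤ 2 * B + ‖T‖ * (1 / 2) := add_le_add (h1 y hy)
          ((T.le_opNorm _).trans (by gcongr))
      _ = _ := by ring
  linarith

theorem inner_toEuclideanCLM {n : ℕ} (M : Matrix (Fin n) (Fin n) ℝ)
    (x y : EuclideanSpace ℝ (Fin n)) :
    inner ℝ x (Matrix.toEuclideanCLM (n := Fin n) (𝕜 := ℝ) M y) =
      ∑ i, ∑ j, x i * y j * M i j := by
  simp only [PiLp.inner_apply, Matrix.ofLp_toEuclideanCLM, Matrix.mulVec, dotProduct,
    RCLike.inner_apply, conj_trivial, Finset.sum_mul]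
  refine Finset.sum_congr rfl fun i _ => Finset.sum_congr rfl fun j _ => by ring

/-! ### Light pairs, and the deterministic error terms. -/

/-- The light part of the form `x ⊗ y`. -/
noncomputable def lightWeight {n : ℕ} (d : ℝ) (x y : Fin n → ℝ) (i j : Fin n) : ℝ :=
  if √d / n < |x i * y j| then 0 else x i * y j

/-- The absolute light part of the form `x ⊗ y` on the edges incident to `S`. -/
noncomputable def incidentLightWeight {n : ℕ} (d : ℝ) (x y : Fin n → ℝ) (S : Finset (Fin n))
    (i j : Fin n) : ℝ :=
  if i ∈ S ∨ j ∈ S then |lightWeight d x y i j| else 0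

section Light

variable {n : ℕ} {d : ℝ} {x y : Fin n → ℝ}

theorem sum_sum_mul_sq_le (hx : ∑ i, x i ^ 2 ≤ 1) (hy : ∑ i, y i ^ 2 ≤ 1) :
    ∑ i, ∑ j, (x i * y j) ^ 2 ≤ 1 := by
  simp only [mul_pow]
  rw [← Finset.sum_mul_sum]
  exact mul_le_one₀ hx (Finset.sum_nonneg fun j _ => sq_nonneg _) hy

theorem abs_lightWeight_le (i j : Fin n) : |lightWeight d x y i j| ≤ √d / n := by
  unfold lightWeight
  split_ifs with h
  · rw [abs_zero]; positivity
  · exact not_lt.1 h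

theorem lightWeight_sq_le (i j : Fin n) : lightWeight d x y i j ^ 2 ≤ (x i * y j) ^ 2 := by
  unfold lightWeight
  split_ifs
  · simpa using sq_nonneg (x i * y j)
  · exact le_rfl

theorem sum_lightWeight_sq_le (hx : ∑ i, x i ^ 2 ≤ 1) (hy : ∑ i, y i ^ 2 ≤ 1) :
    ∑ i, ∑ j, lightWeight d x y i j ^ 2 ≤ 1 :=
  (Finset.sum_le_sum fun i _ => Finset.sum_le_sum fun j _ => lightWeight_sq_le i j).trans
    (sum_sum_mul_sq_le hx hy)

theorem abs_incidentLightWeight_le (S : Finset (Fin n)) (i j : Fin n) :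
    |incidentLightWeight d x y S i j| ≤ |lightWeight d x y i j| := by
  unfold incidentLightWeight
  split_ifs
  · rw [abs_abs]
  · simp

theorem sum_incidentLightWeight_sq_le (hx : ∑ i, x i ^ 2 ≤ 1) (hy : ∑ i, y i ^ 2 ≤ 1)
    (S : Finset (Fin n)) : ∑ i, ∑ j, incidentLightWeight d x y S i j ^ 2 ≤ 1 :=
  (Finset.sum_le_sum fun i _ => Finset.sum_le_sum fun j _ =>
    sq_le_sq.2 (abs_incidentLightWeight_le S i j)).trans (sum_lightWeight_sq_le hx hy)

/-- The expected contribution of the edges incident to a set of at most `10 n / d` vertices. -/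
theorem sum_incidentLightWeight_mul_le (hn : 0 < n) (hd : 0 < d)
    {p : Matrix (Fin n) (Fin n) ℝ} (hp : ∀ i j, n * p i j ≤ d)
    (hx : ∑ i, x i ^ 2 ≤ 1) (hy : ∑ i, y i ^ 2 ≤ 1) {S : Finset (Fin n)}
    (hS : (S.card : ℝ) * d ≤ 10 * n) :
    ∑ i, ∑ j, incidentLightWeight d x y S i j * p i j ≤ 11 * √d := by
  have hn' : (0 : ℝ) < n := by exact_mod_cast hn
  have hw : 0 < √d := Real.sqrt_pos.2 hd
  -- AM-GM on `|z| d / n`, balanced at `|z| = √d / n`. At most `2 |S| n` pairs meet `S`, so the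
  -- total is `√d / 2 + 10 √d`.
  have hpt : ∀ i j, incidentLightWeight d x y S i j * p i j ≤ √d / 2 * (x i * y j) ^ 2 +
      d * √d / (2 * n ^ 2) * ((if i ∈ S then 1 else 0) + if j ∈ S then 1 else 0) := by
    intro i j
    have hrhs : 0 ≤ √d / 2 * (x i * y j) ^ 2 := by positivity
    by_cases h : i ∈ S ∨ j ∈ S
    · have h1 : (1 : ℝ) ≤ (if i ∈ S then 1 else 0) + if j ∈ S then 1 else 0 := by
        rcases h with h | h <;> simp only [h, if_true] <;> split_ifs <;> norm_num
      have hp1 : p i j ≤ d / n := by rw [le_div_iff₀ hn', mul_comm]; exact hp i j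
      set z := lightWeight d x y i j with hz
      have hz2 : |z| ^ 2 ≤ (x i * y j) ^ 2 := by rw [sq_abs]; exact lightWeight_sq_le i j
      calc incidentLightWeight d x y S i j * p i j = |z| * p i j := by
            rw [incidentLightWeight, if_pos h]
        _ ≤ |z| * (d / n) := by gcongr
        _ ≤ √d / 2 * |z| ^ 2 + d * √d / (2 * n ^ 2) := by
            have h2 : √d / 2 * |z| ^ 2 + d * √d / (2 * n ^ 2) - |z| * (d / n)
                = √d / 2 * (|z| - √d / n) ^ 2 := by
              have hdd : d = √d ^ 2 := (Real.sq_sqrt hd.le).symm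
              generalize √d = w at *
              subst hdd
              field_simp
              ring
            have h3 : 0 ≤ √d / 2 * (|z| - √d / n) ^ 2 := by positivity
            linarith
        _ ≤ √d / 2 * (x i * y j) ^ 2 + d * √d / (2 * n ^ 2) * 1 := by
            rw [mul_one]; gcongr
        _ ≤ _ := by gcongr
    · rw [incidentLightWeight, if_neg h, zero_mul]
      refine add_nonneg hrhs (mul_nonneg (by positivity) ?_)
      split_ifs <;> norm_num
  refine (Finset.sum_le_sum fun i _ => Finset.sum_le_sum fun j _ => hpt i j).trans ?_
  simp only [Finset.sum_add_distrib, ← Finset.mul_sum]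
  have hcount : ∑ i : Fin n, ∑ _j : Fin n, (if i ∈ S then (1 : ℝ) else 0) = S.card * n := by
    simp [Finset.sum_ite_irrel, mul_comm]
  have hcount' : ∑ _i : Fin n, ∑ j : Fin n, (if j ∈ S then (1 : ℝ) else 0) = S.card * n := by
    simp [mul_comm]
  rw [hcount, hcount']
  have h1 := sum_sum_mul_sq_le hx hy
  have h2 : d * √d / (2 * n ^ 2) * (S.card * n + S.card * n) = √d * ((S.card * d) / n) := by
    field_simp; ring
  have h3 : (S.card * d) / n ≤ (10 : ℝ) := by rw [div_le_iff₀ hn']; exact hS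
  rw [h2]
  have h4 : √d * ((S.card * d) / n) ≤ √d * 10 := by gcongr
  have h5 : √d / 2 * ∑ i, ∑ j, (x i * y j) ^ 2 ≤ √d / 2 * 1 := by gcongr
  linarith

/-- On heavy pairs `d / n = √d * (√d / n) ≤ √d |x i y j|`, so the linear sum is dominated by a
quadratic one. -/
theorem sum_heavy_mul_le (hn : 0 < n) (hd : 0 < d)
    {p : Matrix (Fin n) (Fin n) ℝ} (hp : ∀ i j, n * p i j ≤ d)
    (hx : ∑ i, x i ^ 2 ≤ 1) (hy : ∑ i, y i ^ 2 ≤ 1) :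
    ∑ i, ∑ j, (if √d / n < |x i * y j| then |x i * y j| * p i j else 0) ≤ √d := by
  have hn' : (0 : ℝ) < n := by exact_mod_cast hn
  have hw : 0 < √d := Real.sqrt_pos.2 hd
  have hpt : ∀ i j, (if √d / n < |x i * y j| then |x i * y j| * p i j else 0) ≤
      √d * (x i * y j) ^ 2 := by
    intro i j
    split_ifs with h
    · have hp1 : p i j ≤ d / n := by rw [le_div_iff₀ hn', mul_comm]; exact hp i j
      calc |x i * y j| * p i j ≤ |x i * y j| * (d / n) := by gcongr
        _ = |x i * y j| * (√d * (√d / n)) := by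
            rw [← mul_div_assoc √d, Real.mul_self_sqrt hd.le]
        _ ≤ |x i * y j| * (√d * |x i * y j|) := by gcongr
        _ = √d * |x i * y j| ^ 2 := by ring
        _ = _ := by rw [sq_abs]
    · positivity
  refine (Finset.sum_le_sum fun i _ => Finset.sum_le_sum fun j _ => hpt i j).trans ?_
  simp only [← Finset.mul_sum]
  exact mul_le_of_le_one_right hw.le (sum_sum_mul_sq_le hx hy)

end Light

/-- Splitting the bilinear form of `A' - p` into light and heavy parts. -/
theorem bilinear_weightReduction_le {n : ℕ} {d : ℝ} {A A' p : Matrix (Fin n) (Fin n) ℝ}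
    {S : Finset (Fin n)} (hA : IsWeightReduction A S A') (hp0 : ∀ i j, 0 ≤ p i j)
    (x y : Fin n → ℝ) :
    ∑ i, ∑ j, x i * y j * (A' i j - p i j) ≤
      ∑ i, ∑ j, lightWeight d x y i j * (A i j - p i j)
      + ∑ i, ∑ j, incidentLightWeight d x y S i j * (A i j - p i j)
      + ∑ i, ∑ j, incidentLightWeight d x y S i j * p i j
      + ∑ i, ∑ j, (if √d / n < |x i * y j| then |x i * y j| * A' i j else 0)
      + ∑ i, ∑ j, (if √d / n < |x i * y j| then |x i * y j| * p i j else 0) := by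
  simp only [← Finset.sum_add_distrib]
  refine Finset.sum_le_sum fun i _ => Finset.sum_le_sum fun j _ => ?_
  have hnn := hA.nonneg i j
  have hle := hA.le i j
  have hp := hp0 i j
  unfold incidentLightWeight lightWeight
  set z := x i * y j with hz
  by_cases hh : √d / n < |z|
  · have h1 : z * A' i j ≤ |z| * A' i j := mul_le_mul_of_nonneg_right (le_abs_self z) hnn
    have h2 : -z * p i j ≤ |z| * p i j := mul_le_mul_of_nonneg_right (neg_le_abs z) hp
    simp only [hh, if_true, abs_zero, ite_self, zero_mul, zero_add]
    linarith
  · simp only [hh, if_false]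
    by_cases hS : i ∈ S ∨ j ∈ S
    · simp only [hS, if_true]
      -- The unknown reduction lies between `0` and `A i j`, so its effect is at most `|z| * A i j`,
      -- free of `A'`.
      have h1 : -z * (A i j - A' i j) ≤ |z| * (A i j - A' i j) :=
        mul_le_mul_of_nonneg_right (neg_le_abs z) (by linarith)
      have h2 : 0 ≤ |z| * A' i j := mul_nonneg (abs_nonneg z) hnn
      linarith
    · simp only [hS, if_false]
      rw [not_or] at hS
      rw [hA.eq_of_notMem i j hS.1 hS.2]
      linarith

/-! ### Union bounds and conclusion. -/

namespace IsInhomogeneousER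

variable {n : ℕ} {Ω : Type*} [MeasurableSpace Ω] {μ : Measure Ω} [IsProbabilityMeasure μ]
  {p : Matrix (Fin n) (Fin n) ℝ} {A : Ω → Matrix (Fin n) (Fin n) ℝ}

/-- The exponent `n (15 r - 1) / 2` beats the entropy `50 ^ n ≤ e ^ (4 n)` and still leaves `r log n
+ 2`. -/
theorem prob_exists_light_ge_le (h : IsInhomogeneousER μ p A) {d : ℝ} (hd : 0 < d) (hn : 0 < n)
    (hp : ∀ i j, n * p i j ≤ d) {ι : Type*} (s : Finset ι) (a : ι → Fin n → Fin n → ℝ)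
    (ha : ∀ k ∈ s, ∀ i j, |a k i j| ≤ √d / n) (ha2 : ∀ k ∈ s, ∑ i, ∑ j, a k i j ^ 2 ≤ 1)
    (hs : s.card ≤ 50 ^ n) {r : ℝ} (hr : 1 ≤ r) :
    μ.real {ω | ∃ k ∈ s, 15 * r * √d ≤ ∑ i, ∑ j, a k i j * (A ω i j - p i j)} ≤
      (n : ℝ) ^ (-r) / 4 := by
  have hn' : (0 : ℝ) < n := by exact_mod_cast hn
  have hn1 : (1 : ℝ) ≤ n := by exact_mod_cast hn
  have hsub : {ω | ∃ k ∈ s, 15 * r * √d ≤ ∑ i, ∑ j, a k i j * (A ω i j - p i j)} ⊆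
      ⋃ k ∈ s, {ω | 15 * r * √d ≤ ∑ i, ∑ j, a k i j * (A ω i j - p i j)} := by
    rintro ω ⟨k, hk, hω⟩
    simp only [Set.mem_iUnion]
    exact ⟨k, hk, hω⟩
  refine (measureReal_mono hsub (measure_ne_top _ _)).trans
    ((measureReal_biUnion_finset_le _ _).trans ?_)
  have he : (50 : ℝ) ≤ Real.exp 4 := by
    have h1 : Real.exp 4 = Real.exp 1 ^ 4 := by rw [← Real.exp_nat_mul]; norm_num
    rw [h1]
    calc (50 : ℝ) ≤ 2.7 ^ 4 := by norm_num
      _ ≤ Real.exp 1 ^ 4 := by gcongr; linarith [Real.exp_one_gt_d9]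
  have h4 : Real.exp (-2) ≤ 1 / 4 := by
    have h1 : Real.exp (-2) = (Real.exp 1 ^ 2)⁻¹ := by
      rw [Real.exp_neg, ← Real.exp_nat_mul]; norm_num
    rw [h1, one_div]
    gcongr
    nlinarith [Real.exp_one_gt_d9]
  have hcard : (s.card : ℝ) ≤ Real.exp (4 * n) := by
    calc (s.card : ℝ) ≤ 50 ^ n := by exact_mod_cast hs
      _ ≤ Real.exp 4 ^ n := by gcongr
      _ = _ := by rw [← Real.exp_nat_mul, mul_comm]
  have hlog := Real.log_le_sub_one_of_pos hn'
  calc ∑ k ∈ s, μ.real {ω | 15 * r * √d ≤ ∑ i, ∑ j, a k i j * (A ω i j - p i j)}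
      ≤ ∑ k ∈ s, Real.exp (-(n / 2 * (15 * r - 1))) :=
        Finset.sum_le_sum fun k hk => h.prob_light_ge_le hd hn hp (a k) (ha k hk) (ha2 k hk) _
    _ = s.card * Real.exp (-(n / 2 * (15 * r - 1))) := by simp
    _ ≤ Real.exp (4 * n) * Real.exp (-(n / 2 * (15 * r - 1))) := by gcongr
    _ ≤ Real.exp (Real.log n * -r) * Real.exp (-2) := by
        rw [← Real.exp_add, ← Real.exp_add, Real.exp_le_exp]
        have h1 : r * Real.log n ≤ r * n := by gcongr; linarith
        have h2 : (n : ℝ) ≤ r * n := le_mul_of_one_le_left hn'.le hr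
        linarith
    _ ≤ Real.exp (Real.log n * -r) * (1 / 4) := by gcongr
    _ = _ := by rw [Real.rpow_def_of_pos hn']; ring

/-- Concentration of all admissible regularizations, with high probability. -/
theorem prob_regularization_ge (h : IsInhomogeneousER μ p A) {d : ℝ} (hd : 0 < d) (hn : 0 < n)
    (hp : ∀ i j, n * p i j ≤ d) {r : ℝ} (hr : 1 ≤ r) :
    1 - (n : ℝ) ^ (-r) ≤
      μ.real {ω | ∀ (S : Finset (Fin n)) (A' : Matrix (Fin n) (Fin n) ℝ),
        (S.card : ℝ) * d ≤ 10 * n → IsWeightReduction (A ω) S A' →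
        (∀ i, weightedDegree A' i ≤ 2 * d) → matrixSpectralNorm (A' - p) ≤ 811200 * r * √d} := by
  have hw : 0 < √d := Real.sqrt_pos.2 hd
  obtain ⟨N, hNcard, hN1, hN⟩ := exists_half_net (EuclideanSpace ℝ (Fin n))
  rw [finrank_euclideanSpace, Fintype.card_fin] at hNcard
  have hNsq : ∀ x ∈ N, ∑ i, x i ^ 2 ≤ 1 := by
    intro x hx
    rw [← EuclideanSpace.real_norm_sq_eq]
    exact pow_le_one₀ (norm_nonneg _) (hN1 x hx)
  have hNN : (N ×ˢ N).card ≤ 25 ^ n := by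
    rw [Finset.card_product]
    calc N.card * N.card ≤ 5 ^ n * 5 ^ n := Nat.mul_le_mul hNcard hNcard
      _ = 25 ^ n := by rw [← mul_pow]; norm_num
  set B₁ : Set Ω := {ω | ∃ k ∈ N ×ˢ N, 15 * r * √d ≤
    ∑ i, ∑ j, lightWeight d k.1 k.2 i j * (A ω i j - p i j)} with hB₁
  set B₂ : Set Ω := {ω | ∃ k ∈ (N ×ˢ N) ×ˢ (Finset.univ : Finset (Finset (Fin n))),
    15 * r * √d ≤
      ∑ i, ∑ j, incidentLightWeight d k.1.1 k.1.2 k.2 i j * (A ω i j - p i j)} with hB₂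
  set B₃ : Set Ω := {ω | ¬ HasDiscrepancy d (24 * r) (A ω)} with hB₃
  have hμ₁ : μ.real B₁ ≤ (n : ℝ) ^ (-r) / 4 := by
    refine h.prob_exists_light_ge_le hd hn hp (N ×ˢ N) (fun k => lightWeight d k.1 k.2) ?_ ?_
      (hNN.trans (Nat.pow_le_pow_left (by norm_num) n)) hr
    · exact fun k _ i j => abs_lightWeight_le i j
    · intro k hk
      obtain ⟨hk1, hk2⟩ := Finset.mem_product.1 hk
      exact sum_lightWeight_sq_le (hNsq _ hk1) (hNsq _ hk2)
  have hμ₂ : μ.real B₂ ≤ (n : ℝ) ^ (-r) / 4 := by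
    refine h.prob_exists_light_ge_le hd hn hp ((N ×ˢ N) ×ˢ Finset.univ)
      (fun k => incidentLightWeight d k.1.1 k.1.2 k.2) ?_ ?_ ?_ hr
    · exact fun k _ i j => (abs_incidentLightWeight_le _ i j).trans (abs_lightWeight_le i j)
    · intro k hk
      obtain ⟨hk1, hk2⟩ := Finset.mem_product.1 (Finset.mem_product.1 hk).1
      exact sum_incidentLightWeight_sq_le (hNsq _ hk1) (hNsq _ hk2) _
    · rw [Finset.card_product, Finset.card_univ, Fintype.card_finset, Fintype.card_fin]
      calc (N ×ˢ N).card * 2 ^ n ≤ 25 ^ n * 2 ^ n := Nat.mul_le_mul_right _ hNN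
        _ = 50 ^ n := by rw [← mul_pow]; norm_num
  have hμ₃ : μ.real B₃ ≤ (n : ℝ) ^ (-r) / 2 := h.prob_not_hasDiscrepancy_le hd hn hp hr
  have hbad : μ.real (B₁ ∪ B₂ ∪ B₃) ≤ (n : ℝ) ^ (-r) := by
    have h1 := measureReal_union_le (μ := μ) (B₁ ∪ B₂) B₃
    have h2 := measureReal_union_le (μ := μ) B₁ B₂
    linarith
  set G : Set Ω := {ω | ∀ (S : Finset (Fin n)) (A' : Matrix (Fin n) (Fin n) ℝ),
    (S.card : ℝ) * d ≤ 10 * n → IsWeightReduction (A ω) S A' →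
    (∀ i, weightedDegree A' i ≤ 2 * d) → matrixSpectralNorm (A' - p) ≤ 811200 * r * √d} with hG
  -- Covering the whole space and using subadditivity avoids any measurability of `G`.
  have hgood : (Set.univ : Set Ω) ⊆ G ∪ (B₁ ∪ B₂ ∪ B₃) := by
    intro ω _
    by_cases hω : ω ∈ B₁ ∪ B₂ ∪ B₃
    · exact Or.inr hω
    left
    simp only [Set.mem_union, not_or] at hω
    obtain ⟨⟨hω₁, hω₂⟩, hω₃⟩ := hω
    have hdisc : HasDiscrepancy d (24 * r) (A ω) := not_not.1 hω₃
    intro S A' hS hA' hdeg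
    -- The five terms add up to `15 + 15 + 11 + 8448 * 24 + 1 = 202794`, rounded up; the net costs a
    -- further factor `4`.
    have hbil : ∀ x ∈ N, ∀ y ∈ N,
        inner ℝ x (Matrix.toEuclideanCLM (n := Fin n) (𝕜 := ℝ) (A' - p) y) ≤
          202800 * r * √d := by
      intro x hx y hy
      rw [inner_toEuclideanCLM]
      simp only [Matrix.sub_apply]
      have e0 := bilinear_weightReduction_le (d := d) hA' h.prob_nonneg x y
      have e1 : ∑ i, ∑ j, lightWeight d x y i j * (A ω i j - p i j) ≤ 15 * r * √d := by
        by_contra hlt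
        exact hω₁ ⟨(x, y), Finset.mem_product.2 ⟨hx, hy⟩, (not_le.1 hlt).le⟩
      have e2 : ∑ i, ∑ j, incidentLightWeight d x y S i j * (A ω i j - p i j) ≤ 15 * r * √d := by
        by_contra hlt
        exact hω₂ ⟨((x, y), S), Finset.mem_product.2
          ⟨Finset.mem_product.2 ⟨hx, hy⟩, Finset.mem_univ _⟩, (not_le.1 hlt).le⟩
      have e3 := sum_incidentLightWeight_mul_le hn hd hp (hNsq x hx) (hNsq y hy) hS
      have e4 := sum_heavy_le hd (by linarith) hA'.symm hA'.nonneg hdeg (hdisc.mono hd hA'.le)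
        (hNsq x hx) (hNsq y hy)
      have e5 := sum_heavy_mul_le hn hd hp (hNsq x hx) (hNsq y hy)
      have e6 : √d ≤ r * √d := le_mul_of_one_le_left hw.le hr
      linarith
    have := opNorm_le_of_half_net hN _ (by positivity) hbil
    rw [matrixSpectralNorm]
    linarith
  have h1 : (1 : ℝ) ≤ μ.real G + μ.real (B₁ ∪ B₂ ∪ B₃) := by
    calc (1 : ℝ) = μ.real Set.univ := by simp
      _ ≤ μ.real (G ∪ (B₁ ∪ B₂ ∪ B₃)) := measureReal_mono hgood
      _ ≤ _ := measureReal_union_le _ _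
  linarith

end IsInhomogeneousER

/-- If all degrees of a nonnegative matrix are at most zero, it vanishes. -/
theorem eq_zero_of_weightedDegree_nonpos {n : ℕ} {M : Matrix (Fin n) (Fin n) ℝ}
    (hM : ∀ i j, 0 ≤ M i j) (hdeg : ∀ i, weightedDegree M i ≤ 0) : M = 0 := by
  ext i j
  have h1 : ∑ j, M i j = 0 := le_antisymm (hdeg i) (Finset.sum_nonneg fun j _ => hM i j)
  exact (Finset.sum_eq_zero_iff_of_nonneg fun j _ => hM i j).1 h1 j (Finset.mem_univ j)

theorem mainTheorem1 :
    ∃ C : ℝ, 0 < C ∧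
      ∀ (n : ℕ) (Ω : Type*) [MeasurableSpace Ω] (μ : Measure Ω) [IsProbabilityMeasure μ]
        (p : Matrix (Fin n) (Fin n) ℝ) (A : Ω → Matrix (Fin n) (Fin n) ℝ) (d : ℝ),
        IsInhomogeneousER μ p A →
        IsGreatest (Set.range fun e : Fin n × Fin n => (n : ℝ) * p e.1 e.2) d →
        ∀ r : ℝ, 1 ≤ r →
          1 - (n : ℝ) ^ (-r) ≤
            μ.real {ω | ∀ (S : Finset (Fin n)) (A' : Matrix (Fin n) (Fin n) ℝ),
              (S.card : ℝ) * d ≤ 10 * n →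
              IsWeightReduction (A ω) S A' →
              (∀ i, weightedDegree A' i ≤ 2 * d) →
              matrixSpectralNorm (A' - expectedMatrix μ A) ≤ C * r ^ (3 / 2 : ℝ) * Real.sqrt d} := by
  refine ⟨811200, by norm_num, ?_⟩
  intro n Ω _ μ _ p A d h hgreat r hr
  obtain ⟨⟨e, he⟩, hmax⟩ := hgreat
  have hn : 0 < n := e.1.pos
  have hn' : (0 : ℝ) < n := by exact_mod_cast hn
  have hp : ∀ i j, n * p i j ≤ d := fun i j => hmax ⟨(i, j), rfl⟩
  have hd0 : 0 ≤ d := he ▸ mul_nonneg hn'.le (h.prob_nonneg _ _)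
  rw [h.expectedMatrix_eq]
  -- For `d = 0` the tilts and densities degenerate, but then both `p` and `A'` vanish.
  rcases hd0.eq_or_lt with rfl | hd
  · have hp0 : p = 0 := by
      ext i j
      have := hp i j
      exact le_antisymm (by
        rw [Matrix.zero_apply]
        exact nonpos_of_mul_nonpos_right this hn') (h.prob_nonneg i j)
    have huniv : {ω | ∀ (S : Finset (Fin n)) (A' : Matrix (Fin n) (Fin n) ℝ),
        (S.card : ℝ) * 0 ≤ 10 * n → IsWeightReduction (A ω) S A' →
        (∀ i, weightedDegree A' i ≤ 2 * 0) →
        matrixSpectralNorm (A' - p) ≤ 811200 * r ^ (3 / 2 : ℝ) * √0} = Set.univ := by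
      refine Set.eq_univ_of_forall fun ω S A' _ hA' hdeg => ?_
      rw [eq_zero_of_weightedDegree_nonpos hA'.nonneg (by simpa using hdeg), hp0]
      simp [matrixSpectralNorm]
    rw [huniv, probReal_univ]
    linarith [Real.rpow_nonneg hn'.le (-r)]
  · refine (h.prob_regularization_ge hd hn hp hr).trans (measureReal_mono ?_)
    intro ω hω S A' hS hA' hdeg
    refine (hω S A' hS hA' hdeg).trans ?_
    have : r ≤ r ^ (3 / 2 : ℝ) := Real.self_le_rpow_of_one_le hr (by norm_num)
    gcongr
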